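/- **Notation.** A \emph{$K$-tuple} over $n$ variables is a map $C:\{\pm1\}^n\to\{\pm1\}^K$ whose output coordinates are literals $\psi\mapsto\pm\psi_j$ on $K$ different variables; a \emph{$K$-formula} $J=(C_1,\dots,C_m)$ is a sequence of $m$ $K$-tuples, and its value is $\mathrm{VAL}(J)=\max_{\psi\in\{\pm1\}^n}\frac1m\left|\{j:\prod_{i=1}^K C_j(\psi)_i=1\}\right|$. For constants $K$ and $0<\eta<\frac12$ and a polynomially bounded $m=m(n)$, the problem $\mathrm{CSP}^{\mathrm{rand},1-\eta}_{m}(\mathrm{XOR}_K)$ is \emph{easy} if there is a randomized $\mathrm{poly}(n)$-time algorithm $\mathcal A$ whose input is a $K$-formula $J$ with $n$ variables and $m(n)$ constraints, such that (i) if $\mathrm{VAL}(J)\ge 1-\eta$, then $\Pr_{\text{coins}}(\mathcal A(J)=\text{``non-random''})\ge\frac34$, and (ii) if the constraints of $J$ are chosen independently and uniformly from all $K$-tuples, then with probability $1-o_n(1)$ over $J$, $\Pr_{\text{coins}}(\mathcal A(J)=\text{``random''})\ge\frac34$. Otherwise the problem is \emph{hard}. For a distribution $\mathcal D$ on $\{-1,0,1\}^n\times\{\pm1\}$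 and $h:\{-1,0,1\}^n\to\{\pm1\}$ let $\mathrm{Err}_{\mathcal D}(h)=\Pr_{(x,y)\sim\mathcal D}(h(x)\ne y)$ and $\mathrm{Err}_{\mathrm{HALF}}(\mathcal D)=\min_{w\in\mathbb R^n}\mathrm{Err}_{\mathcal D}(x\mapsto\mathrm{sign}\langle w,x\rangle)$, where $\mathrm{sign}(0)=1$; $\mathcal D$ is \emph{$\eta$-almost-realizable} if $\mathrm{Err}_{\mathrm{HALF}}(\mathcal D)\le\eta$. A learning algorithm receives $n$ and independent examples drawn from $\mathcal D$, may toss coins, and outputs a description of a hypothesis $h:\{-1,0,1\}^n\to\{\pm1\}$ of any form; it is \emph{efficient} if it runs in time $\mathrm{poly}(n)$ and its hypotheses can be evaluated in time $\mathrm{poly}(n)$ from their descriptions. It has \emph{non-trivial performance} on a family of distributions if there are constants $c,\delta>0$ such that for all sufficiently large $n$ and every distribution $\mathcal D$ of the family on $\{-1,0,1\}^n\times\{\pm1\}$, with probability at least $\delta$ its hypothesis satisfies $\mathrm{Err}_{\mathcal D}(h)\le\frac12-\frac1{n^c}$. **Theorem.** Suppose that for every integer $K>4$ the problem $\mathrm{CSP}^{\mathrm{rand},1-\frac1{100}}_{\lfloor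 n^{K/4}\rfloor}(\mathrm{XOR}_K)$ is hard. Then no efficient learning algorithm has non-trivial performance on the $\frac2{100}$-almost-realizable distributions on $\{-1,0,1\}^n\times\{\pm1\}$. -/

import Mathlib

/-! ## Programs with a step count

Values are binary trees, programs are built from the LISP primitives `nil`, `cons`, `head`, `tail`
by sequencing, branching and while-loops, and every primitive and every control decision costs at
least one step. Trees are immutable, so an implementation passes pointers to shared cells and every
step is a bounded number of pointer operations: step counts are polynomially related to the running
time of Turing machines. There is no test for equality of trees, only a test for `nil`. -/

namespace XorHalf

/-- Values: binary trees. -/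
inductive Data : Type
  | nil : Data
  | cons : Data → Data → Data

/-- First component of a pair (`nil` has none; the result is then `nil`). -/
def Data.head : Data → Data
  | .nil => .nil
  | .cons a _ => a

/-- Second component of a pair (`nil` has none; the result is then `nil`). -/
def Data.tail : Data → Data
  | .nil => .nil
  | .cons _ b => b

/-- Programs; each maps an input value to an output value, if it halts. -/
inductive Prog : Type
  /-- return the input -/
  | skip : Prog
  /-- return `nil` -/
  | nil : Prog
  /-- return the first component of the input -/
  | head : Prog
  /-- return the second component of the input -/
  | tail : Prog
  /-- run both programs on the input and return the pair of the results -/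
  | pair : Prog → Prog → Prog
  /-- run the first program, then the second on its result -/
  | seq : Prog → Prog → Prog
  /-- run the first program on the input as a test; if the result is not `nil`, run the second
  program on the input, otherwise the third -/
  | cond : Prog → Prog → Prog → Prog
  /-- as long as the first program, run on the current value, does not return `nil`, replace the
  current value by the result of the second -/
  | loop : Prog → Prog → Prog

/-- `Eval p a v t`: on input `a` the program `p` halts with output `v` after exactly `t` steps. -/
inductive Eval : Prog → Data → Data → ℕ → Prop
  | skip (a : Data) : Eval .skip a a 1
  | nil (a : Data) : Eval .nil a .nil 1
  | head (a : Data) : Eval .head a a.head 1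
  | tail (a : Data) : Eval .tail a a.tail 1
  | pair {f g : Prog} {a u v : Data} {s t : ℕ} :
      Eval f a u s → Eval g a v t → Eval (.pair f g) a (.cons u v) (s + t + 1)
  | seq {f g : Prog} {a u v : Data} {s t : ℕ} :
      Eval f a u s → Eval g u v t → Eval (.seq f g) a v (s + t + 1)
  | cond_true {p f g : Prog} {a u v : Data} {s t : ℕ} :
      Eval p a u s → u ≠ .nil → Eval f a v t → Eval (.cond p f g) a v (s + t + 1)
  | cond_false {p f g : Prog} {a v : Data} {s t : ℕ} :
      Eval p a .nil s → Eval g a v t → Eval (.cond p f g) a v (s + t + 1)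
  | loop_stop {p f : Prog} {a : Data} {s : ℕ} :
      Eval p a .nil s → Eval (.loop p f) a a (s + 1)
  | loop_step {p f : Prog} {a u v w : Data} {s t r : ℕ} :
      Eval p a u s → u ≠ .nil → Eval f a v t → Eval (.loop p f) v w r →
        Eval (.loop p f) a w (s + t + r + 1)

/-- On input `a` the program `p` halts with output `v` after at most `T` steps. -/
def HaltsWithin (p : Prog) (a v : Data) (T : ℕ) : Prop :=
  ∃ t ≤ T, Eval p a v t

/-! ## Encodings -/

/-- A list of values as one value. -/
def encList : List Data → Data
  | [] => .nil
  | a :: l => .cons a (encList l)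

/-- A natural number in unary. -/
def encNat : ℕ → Data
  | 0 => .nil
  | k + 1 => .cons .nil (encNat k)

/-- A bit. -/
def encBool : Bool → Data
  | false => .nil
  | true => .cons .nil .nil

/-- An element of `{±1}` (the type `ℤˣ`). -/
def encUnit (u : ℤˣ) : Data :=
  if u = 1 then .cons .nil .nil else .nil

/-- An element of `{-1, 0, 1}`. -/
def encSign : SignType → Data
  | .zero => .nil
  | .pos => .cons .nil .nil
  | .neg => .cons (.cons .nil .nil) .nil

/-- A finite string of coins. -/
def encCoins {t : ℕ} (r : Fin t → Bool) : Data :=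
  encList (List.ofFn fun i => encBool (r i))

/-! ## Uniform probability on a finite type -/

open Classical in
/-- Probability of the event `E` under the uniform distribution. -/
noncomputable def unifProb {α : Type} [Fintype α] (E : α → Prop) : ℝ :=
  ((Finset.univ.filter E).card : ℝ) / (Fintype.card α : ℝ)

/-! ## The random `K`-XOR problem -/

/-- `K`-tuples over `n` variables: `K` literals on `K` different variables. The `i`-th literal is
the variable `C.1 i`, negated iff `C.2 i = -1`. -/
abbrev KTuple (n K : ℕ) : Type := (Fin K ↪ Fin n) × (Fin K → ℤˣ)

/-- The vector `C(ψ)` in `{±1}^K`. -/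
def KTuple.eval {n K : ℕ} (C : KTuple n K) (ψ : Fin n → ℤˣ) : Fin K → ℤˣ :=
  fun i => C.2 i * ψ (C.1 i)

/-- The XOR of `K` signs. -/
def xor {K : ℕ} (z : Fin K → ℤˣ) : ℤˣ := ∏ i, z i

/-- `K`-formulas with `n` variables and `m` constraints. -/
abbrev KFormula (n K m : ℕ) : Type := Fin m → KTuple n K

/-- The fraction of constraints of `J` that `ψ` satisfies. -/
noncomputable def valAt {n K m : ℕ} (J : KFormula n K m) (ψ : Fin n → ℤˣ) : ℝ :=
  ((Finset.univ.filter fun j => xor ((J j).eval ψ) = 1).card : ℝ) / (m : ℝ)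

/-- The value of `J`: the maximum over all assignments. -/
noncomputable def val {n K m : ℕ} (J : KFormula n K m) : ℝ := ⨆ ψ, valAt J ψ

/-- A `K`-tuple, as the list of its literals, each a pair of a variable and a sign. -/
def encKTuple {n K : ℕ} (C : KTuple n K) : Data :=
  encList (List.ofFn fun i => Data.cons (encNat (C.1 i)) (encUnit (C.2 i)))

/-- The input of a randomized algorithm for the `K`-XOR problem: the number of variables, the
formula, and the coins. -/
def encXorInput {n K m t : ℕ} (J : KFormula n K m) (r : Fin t → Bool) : Data :=
  .cons (encNat n) (.cons (encList (List.ofFn fun j => encKTuple (J j))) (encCoins r))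

/-- The problem `CSP^{rand,1-η}_{m}(XOR_K)` is easy (for constant `K` and `η`, and `m = m(n)`
polynomially bounded): some program, using `n ^ b + b` coins and at most `n ^ b + b` steps, says
"non-random" (`true`) with probability at least `3/4` on every formula of value at least `1 - η`,
and says "random" (`false`) with probability at least `3/4` on all but an `o(1)` fraction of all
formulas. `A n J r` is its answer on the formula `J` with coins `r`. -/
def XorEasy (K : ℕ) (η : ℝ) (m : ℕ → ℕ) : Prop :=
  ∃ (p : Prog) (b : ℕ) (A : ∀ n, KFormula n K (m n) → (Fin (n ^ b + b) → Bool) → Bool),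
    (∀ n J r, HaltsWithin p (encXorInput J r) (encBool (A n J r)) (n ^ b + b)) ∧
    (∀ n J, 1 - η ≤ val J → 3 / 4 ≤ unifProb fun r => A n J r = true) ∧
    Filter.Tendsto
      (fun n => unifProb fun J : KFormula n K (m n) =>
        ¬ (3 / 4 ≤ unifProb fun r => A n J r = false))
      Filter.atTop (nhds 0)

/-- The problem `CSP^{rand,1-η}_{m}(XOR_K)` is hard. -/
def XorHard (K : ℕ) (η : ℝ) (m : ℕ → ℕ) : Prop := ¬ XorEasy K η m

/-! ## Learning halfspaces -/

/-- Instances: `{-1, 0, 1}^n`. -/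
abbrev Inst (n : ℕ) : Type := Fin n → SignType

/-- Examples: `{-1, 0, 1}^n × {±1}`. -/
abbrev Example (n : ℕ) : Type := Inst n × ℤˣ

/-- The halfspace classifier `x ↦ sign ⟨w, x⟩`, with `sign 0 = 1`. -/
noncomputable def halfspace {n : ℕ} (w : Fin n → ℝ) (x : Inst n) : ℤˣ :=
  if 0 ≤ ∑ i, w i * ((x i : SignType) : ℝ) then 1 else -1

/-- The error of the classifier `h` under the distribution `D`. -/
noncomputable def err {n : ℕ} (D : Example n → ℝ) (h : Inst n → ℤˣ) : ℝ :=
  ∑ e, if h e.1 ≠ e.2 then D e else 0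

/-- The error of the best halfspace under `D`. -/
noncomputable def errHalf {n : ℕ} (D : Example n → ℝ) : ℝ :=
  ⨅ w : Fin n → ℝ, err D (halfspace w)

/-- An instance as a value. -/
def encInst {n : ℕ} (x : Inst n) : Data := encList (List.ofFn fun i => encSign (x i))

/-- The input of a learning algorithm: the dimension, the examples drawn, and the coins. -/
def encLearnInput {n s t : ℕ} (S : Fin s → Example n) (r : Fin t → Bool) : Data :=
  .cons (encNat n)
    (.cons (encList (List.ofFn fun i => Data.cons (encInst (S i).1) (encUnit (S i).2)))
      (encCoins r))

/-- A learning rule over all dimensions `n`: from `n ^ b + b` examples and `n ^ b + b` coins it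
makes a hypothesis. -/
abbrev LearningRule (b : ℕ) : Type :=
  ∀ n, (Fin (n ^ b + b) → Example n) → (Fin (n ^ b + b) → Bool) → Inst n → ℤˣ

/-- The learning rule `H` is efficient: a program `L` computes a description `d` of the hypothesis,
and a program `E` evaluates hypotheses given their descriptions, both in at most `n ^ b + b`
steps. -/
def Efficient {b : ℕ} (H : LearningRule b) : Prop :=
  ∃ L E : Prog, ∀ n (S : Fin (n ^ b + b) → Example n) (r : Fin (n ^ b + b) → Bool),
    ∃ d : Data, HaltsWithin L (encLearnInput S r) d (n ^ b + b) ∧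
      ∀ x : Inst n, HaltsWithin E (.cons d (encInst x)) (encUnit (H n S r x)) (n ^ b + b)

/-- The probability, over independent examples drawn from `D` and over the coins, that the
hypothesis has error at most `ε` under `D`. -/
noncomputable def successProb {b n : ℕ} (H : LearningRule b) (D : Example n → ℝ) (ε : ℝ) : ℝ :=
  ∑ S : Fin (n ^ b + b) → Example n, (∏ i, D (S i)) * unifProb fun r => err D (H n S r) ≤ ε

/-- `H` has non-trivial performance on the `η`-almost-realizable distributions on
`{-1, 0, 1}^n × {±1}`: for some `c > 0`, with at least some constant probability `δ > 0`, its
hypothesis has error at most `1/2 - n^{-c}`, for all large `n`. -/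
def NonTrivial {b : ℕ} (H : LearningRule b) (η : ℝ) : Prop :=
  ∃ c > (0 : ℝ), ∃ δ > (0 : ℝ), ∀ᶠ n : ℕ in Filter.atTop,
    ∀ D ∈ stdSimplex ℝ (Example n), errHalf D ≤ η →
      δ ≤ successProb H D (1 / 2 - 1 / (n : ℝ) ^ c)

end XorHalf

/-! A learner with non-trivial performance would refute random parity constraints. Let K = 4κ and m
= n^κ. In each constraint the sign of the first literal becomes the label, and the other signs form
a vector v in {-1,0,1}^n with K nonzero entries. If ψ satisfies the constraint, the label is the
parity of K signs whose sum is s = ⟨ψ, v⟩, and s determines this parity. When |s| ≤ 4γ, the parity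
is the sign of a polynomial in s of degree 4γ with roots at the odd integers between -4γ and 4γ. It
is therefore a halfspace over the 4γ-th tensor power of (1, v), in dimension (n+1)^(4γ)
(`exists_halfspace_eq_prod`).

Suppose that for any two variables the sign products cancel over the formula up to n^(κ-2). Then for
every ψ the mean of s² is at most K + 1 (`Balanced.sum_sq_le`), so some γ of order √K is large
enough for all but 1/200 of the constraints. A balanced formula of value at least 99/100 thus yields
an almost-realizable distribution, and the learner beats 1/2 on it (`errHalf_exampleDist_le`,
`le_numCorrect`). Its sample size is n^O(γ) and its advantage n^(-O(γ)), with constants that depend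
only on the learner. Since γ is of order √κ, a large κ makes n^κ constraints far more than the
learner can memorize.

In a random formula the labels are independent of the vectors, so a hypothesis learnt from few
constraints is right on about half of them (`unifProb_numCorrect_le`). Such a formula is also
balanced with high probability (`unifProb_not_balanced_le`). The test "unbalanced, or one of n runs
of the learner does well on the whole formula" therefore separates the two cases. That it is a
polynomial-time program (`exists_prog_accept`) follows from closure properties of `Comp`. -/

namespace XorHalf

/-! ## Polynomially bounded functions -/

/-- `f` is bounded by a polynomial in the size `sz`. -/
def PolyBdd {ι : Type} (sz f : ι → ℕ) : Prop := ∃ b, ∀ i, f i ≤ (sz i + 2) ^ b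

section PolyBdd
variable {ι : Type} {sz f g : ι → ℕ}

theorem PolyBdd.mono (hf : PolyBdd sz f) (h : ∀ i, g i ≤ f i) : PolyBdd sz g :=
  let ⟨b, hb⟩ := hf
  ⟨b, fun i => (h i).trans (hb i)⟩

/-- The shift by two in `PolyBdd` keeps the base at least two, so that an exponent can absorb any
constant even at size zero. -/
theorem PolyBdd.const (c : ℕ) : PolyBdd sz (fun _ => c) :=
  ⟨c, fun i => Nat.lt_two_pow_self.le.trans (Nat.pow_le_pow_left (by omega) c)⟩

theorem PolyBdd.self : PolyBdd sz sz := ⟨1, fun i => by simp⟩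

theorem PolyBdd.add (hf : PolyBdd sz f) (hg : PolyBdd sz g) :
    PolyBdd sz (fun i => f i + g i) := by
  obtain ⟨a, ha⟩ := hf
  obtain ⟨b, hb⟩ := hg
  refine ⟨a + b + 1, fun i => ?_⟩
  have h1 : (sz i + 2) ^ a ≤ (sz i + 2) ^ (a + b) := Nat.pow_le_pow_right (by omega) (by omega)
  have h2 : (sz i + 2) ^ b ≤ (sz i + 2) ^ (a + b) := Nat.pow_le_pow_right (by omega) (by omega)
  have := ha i
  have := hb i
  rw [pow_succ]
  nlinarith [Nat.zero_le (sz i), Nat.zero_le ((sz i + 2) ^ (a + b) * sz i)]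

theorem PolyBdd.mul (hf : PolyBdd sz f) (hg : PolyBdd sz g) :
    PolyBdd sz (fun i => f i * g i) := by
  obtain ⟨a, ha⟩ := hf
  obtain ⟨b, hb⟩ := hg
  exact ⟨a + b, fun i => by rw [pow_add]; exact Nat.mul_le_mul (ha i) (hb i)⟩

theorem PolyBdd.pow (hf : PolyBdd sz f) (c : ℕ) : PolyBdd sz (fun i => f i ^ c) := by
  obtain ⟨a, ha⟩ := hf
  exact ⟨a * c, fun i => by rw [pow_mul]; exact Nat.pow_le_pow_left (ha i) c⟩

theorem PolyBdd.reindex {κ : Type} {sz' : κ → ℕ} (u : κ → ι) (hf : PolyBdd sz f)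
    (h : ∀ x, sz (u x) ≤ sz' x) : PolyBdd sz' (fun x => f (u x)) := by
  obtain ⟨a, ha⟩ := hf
  exact ⟨a, fun x => (ha (u x)).trans (Nat.pow_le_pow_left (by have := h x; omega) a)⟩

/-- Conversion to the format of the definitions of efficiency. Sizes at least two satisfy `sz + 2 ≤
sz ^ 2`; the summand `3 ^ a` covers sizes zero and one. Having all large `b` available lets several
bounds share one exponent. -/
theorem PolyBdd.exists_pow_add (hf : PolyBdd sz f) :
    ∃ b₀, ∀ b ≥ b₀, ∀ i, f i ≤ sz i ^ b + b := by
  obtain ⟨a, ha⟩ := hf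
  refine ⟨2 * a + 3 ^ a, fun b hb i => (ha i).trans ?_⟩
  rcases Nat.lt_or_ge (sz i) 2 with h | h
  · calc (sz i + 2) ^ a ≤ 3 ^ a := Nat.pow_le_pow_left (by omega) a
      _ ≤ _ := by omega
  · calc (sz i + 2) ^ a ≤ (sz i ^ 2) ^ a := Nat.pow_le_pow_left (by nlinarith) a
      _ = sz i ^ (2 * a) := (pow_mul _ _ _).symm
      _ ≤ sz i ^ b := Nat.pow_le_pow_right (by omega) ((Nat.le_add_right _ _).trans hb)
      _ ≤ _ := by omega

end PolyBdd

/-! ## Families of values computable in polynomial time -/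

theorem HaltsWithin.mono {p : Prog} {a v : Data} {s t : ℕ} (h : HaltsWithin p a v s)
    (hst : s ≤ t) : HaltsWithin p a v t :=
  let ⟨r, hr, he⟩ := h
  ⟨r, hr.trans hst, he⟩

/-- A single program maps `inp i` to `out i` for every `i`, in time polynomial in `sz i`. -/
def Comp {ι : Type} (sz : ι → ℕ) (inp out : ι → Data) : Prop :=
  ∃ (p : Prog) (t : ι → ℕ), PolyBdd sz t ∧ ∀ i, HaltsWithin p (inp i) (out i) (t i)

section Comp
variable {ι : Type} {sz : ι → ℕ} {inp f g : ι → Data}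

theorem Comp.id : Comp sz inp inp :=
  ⟨.skip, fun _ => 1, .const 1, fun _ => ⟨1, le_rfl, .skip _⟩⟩

theorem Comp.nil : Comp sz inp (fun _ => .nil) :=
  ⟨.nil, fun _ => 1, .const 1, fun _ => ⟨1, le_rfl, .nil _⟩⟩

theorem Comp.comp (hf : Comp sz inp f) (hg : Comp sz f g) : Comp sz inp g := by
  obtain ⟨p, s, hs, hp⟩ := hf
  obtain ⟨q, t, ht, hq⟩ := hg
  refine ⟨.seq p q, fun i => s i + t i + 1, (hs.add ht).add (.const 1), fun i => ?_⟩
  obtain ⟨s', hs', he⟩ := hp i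
  obtain ⟨t', ht', he'⟩ := hq i
  exact ⟨s' + t' + 1, by dsimp only; omega, .seq he he'⟩

theorem Comp.cons (hf : Comp sz inp f) (hg : Comp sz inp g) :
    Comp sz inp (fun i => .cons (f i) (g i)) := by
  obtain ⟨p, s, hs, hp⟩ := hf
  obtain ⟨q, t, ht, hq⟩ := hg
  refine ⟨.pair p q, fun i => s i + t i + 1, (hs.add ht).add (.const 1), fun i => ?_⟩
  obtain ⟨s', hs', he⟩ := hp i
  obtain ⟨t', ht', he'⟩ := hq i
  exact ⟨s' + t' + 1, by dsimp only; omega, .pair he he'⟩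

theorem Comp.head (hf : Comp sz inp f) : Comp sz inp (fun i => (f i).head) :=
  hf.comp ⟨.head, fun _ => 1, .const 1, fun _ => ⟨1, le_rfl, .head _⟩⟩

theorem Comp.tail (hf : Comp sz inp f) : Comp sz inp (fun i => (f i).tail) :=
  hf.comp ⟨.tail, fun _ => 1, .const 1, fun _ => ⟨1, le_rfl, .tail _⟩⟩

theorem Comp.fst {x y : ι → Data} (hf : Comp sz inp (fun i => .cons (x i) (y i))) :
    Comp sz inp x := hf.head

theorem Comp.snd {x y : ι → Data} (hf : Comp sz inp (fun i => .cons (x i) (y i))) :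
    Comp sz inp y := hf.tail

theorem Comp.const (d : Data) : Comp sz inp (fun _ => d) := by
  induction d with
  | nil => exact .nil
  | cons a b iha ihb => exact iha.cons ihb

theorem Comp.congr (hf : Comp sz inp f) (h : ∀ i, f i = g i) : Comp sz inp g :=
  (funext h : f = g) ▸ hf

theorem Comp.reindex {κ : Type} (u : κ → ι) (hf : Comp sz inp f) :
    Comp (fun x => sz (u x)) (fun x => inp (u x)) (fun x => f (u x)) := by
  obtain ⟨p, s, hs, hp⟩ := hf
  exact ⟨p, fun x => s (u x), hs.reindex u fun _ => le_rfl, fun x => hp (u x)⟩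

theorem Comp.ite' {P : ι → Prop} [∀ i, Decidable (P i)] {t : ι → Data} (ht : Comp sz inp t)
    (htP : ∀ i, t i ≠ .nil ↔ P i)
    (hf : Comp (fun x : {i // P i} => sz x) (fun x => inp x) (fun x => f x))
    (hg : Comp (fun x : {i // ¬ P i} => sz x) (fun x => inp x) (fun x => g x)) :
    Comp sz inp (fun i => if P i then f i else g i) := by
  obtain ⟨r, k, ⟨a, ha⟩, hr⟩ := ht
  obtain ⟨p, s, ⟨b, hb⟩, hp⟩ := hf
  obtain ⟨q, t, ⟨c, hc⟩, hq⟩ := hg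
  refine ⟨.cond r p q, fun i => (sz i + 2) ^ a + ((sz i + 2) ^ b + (sz i + 2) ^ c) + 1,
    (PolyBdd.add ⟨a, fun _ => le_rfl⟩
      (PolyBdd.add ⟨b, fun _ => le_rfl⟩ ⟨c, fun _ => le_rfl⟩)).add (.const 1), fun i => ?_⟩
  obtain ⟨k', hk', he⟩ := hr i
  have hka := ha i
  by_cases h : P i
  · obtain ⟨s', hs', he'⟩ := hp ⟨i, h⟩
    have hsb := hb ⟨i, h⟩
    simp only [if_pos h]
    refine ⟨k' + s' + 1, ?_, .cond_true he ((htP i).2 h) he'⟩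
    simp only at hsb
    omega
  · obtain ⟨s', hs', he'⟩ := hq ⟨i, h⟩
    have hsb := hc ⟨i, h⟩
    simp only [if_neg h]
    have hn : _ = Data.nil := not_not.1 (mt (htP i).1 h)
    refine ⟨k' + s' + 1, ?_, .cond_false (hn ▸ he) he'⟩
    simp only at hsb
    omega

theorem Comp.ite {P : ι → Prop} [∀ i, Decidable (P i)] {t : ι → Data} (ht : Comp sz inp t)
    (htP : ∀ i, t i ≠ .nil ↔ P i) (hf : Comp sz inp f) (hg : Comp sz inp g) :
    Comp sz inp (fun i => if P i then f i else g i) :=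
  ht.ite' htP (hf.reindex _) (hg.reindex _)

end Comp

theorem encNat_ne_nil {k : ℕ} : encNat k ≠ .nil ↔ k ≠ 0 := by
  cases k <;> simp [encNat]

/-- Bounded primitive recursion. -/
theorem Comp.natRec {ι : Type} {sz : ι → ℕ} {inp : ι → Data} {q : ι → ℕ} {s : ι → ℕ → Data}
    (hqb : PolyBdd sz q) (hq : Comp sz inp (fun i => encNat (q i)))
    (h0 : Comp sz inp (fun i => s i 0))
    (hs : Comp (fun x : (i : ι) × Fin (q i) => sz x.1)
      (fun x => .cons (inp x.1) (.cons (encNat x.2) (s x.1 x.2)))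
      (fun x => s x.1 (x.2 + 1))) :
    Comp sz inp (fun i => s i (q i)) := by
  obtain ⟨p, t, ⟨b, hb⟩, hp⟩ := hs
  -- The loop state consists of the context, the number of remaining rounds, the current index and
  -- the accumulator. The rounds count down because the only test is for `nil`; the index counts up
  -- because the body reads it.
  have hinit : Comp sz inp (fun i => .cons (inp i) (.cons (encNat (q i))
      (.cons (encNat 0) (s i 0)))) := Comp.id.cons (hq.cons (Comp.nil.cons h0))
  refine hinit.comp (g := fun i => s i (q i)) ?_
  suffices hl : Comp sz (fun i => .cons (inp i) (.cons (encNat (q i)) (.cons (encNat 0) (s i 0))))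
      (fun i => .cons (inp i) (.cons (encNat 0) (.cons (encNat (q i)) (s i (q i))))) from
    hl.snd.snd.snd
  -- Induction on the remaining rounds `j`. The 50 pays for the bookkeeping around `p` in one round.
  have key : ∀ i j k, k + j = q i →
      HaltsWithin (.loop (.seq .tail .head)
        (.pair .head (.pair (.seq .tail (.seq .head .tail))
          (.pair (.pair .nil (.seq .tail (.seq .tail .head)))
            (.seq (.pair .head (.seq .tail .tail)) p)))))
        (.cons (inp i) (.cons (encNat j) (.cons (encNat k) (s i k))))
        (.cons (inp i) (.cons (encNat 0) (.cons (encNat (q i)) (s i (q i)))))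
        (j * ((sz i + 2) ^ b + 50) + 10) := by
    intro i j
    induction j with
    | zero =>
      rintro k rfl
      exact ⟨4, by omega, Eval.loop_stop (.seq (.tail _) (.head _))⟩
    | succ j ih =>
      intro k hk
      obtain ⟨r, hr, her⟩ := ih (k + 1) (by omega)
      obtain ⟨t', ht', het⟩ := hp ⟨i, ⟨k, by omega⟩⟩
      have htb := hb ⟨i, ⟨k, by omega⟩⟩
      have e1 : Eval (.pair .head (.pair (.seq .tail (.seq .head .tail))
          (.pair (.pair .nil (.seq .tail (.seq .tail .head)))
            (.seq (.pair .head (.seq .tail .tail)) p))))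
          (.cons (inp i) (.cons (encNat (j + 1)) (.cons (encNat k) (s i k))))
          (.cons (inp i) (.cons (encNat j) (.cons (encNat (k + 1)) (s i (k + 1))))) _ :=
        .pair (.head _) (.pair (.seq (.tail _) (.seq (.head _) (.tail _)))
          (.pair (.pair (.nil _) (.seq (.tail _) (.seq (.tail _) (.head _))))
            (.seq (.pair (.head _) (.seq (.tail _) (.tail _))) het)))
      refine ⟨_, ?_, .loop_step (.seq (.tail _) (.head _)) ?_ e1 her⟩
      · simp only at htb
        rw [add_mul, one_mul]
        omega
      · simp [encNat, Data.tail, Data.head]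
  exact ⟨_, fun i => q i * ((sz i + 2) ^ b + 50) + 10,
    (hqb.mul (PolyBdd.add ⟨b, fun _ => le_rfl⟩ (.const 50))).add (.const 10),
    fun i => key i (q i) 0 (by omega)⟩

/-! ## Propositions -/

open Classical in
/-- The truth value of a proposition as a value. -/
noncomputable def encProp (p : Prop) : Data := encBool (decide p)

theorem encProp_ne_nil {p : Prop} : encProp p ≠ .nil ↔ p := by
  by_cases h : p <;> simp [encProp, encBool, h]

section
variable {ι : Type} {sz : ι → ℕ} {inp : ι → Data}

theorem Comp.prop {P : ι → Prop} {t : ι → Data} (ht : Comp sz inp t)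
    (h : ∀ i, t i ≠ .nil ↔ P i) : Comp sz inp (fun i => encProp (P i)) := by
  classical
  refine (ht.ite h (.const (encBool true)) (.const (encBool false))).congr fun i => ?_
  by_cases hi : P i <;> simp [encProp, hi]

theorem Comp.not {P : ι → Prop} (hP : Comp sz inp (fun i => encProp (P i))) :
    Comp sz inp (fun i => encProp (¬ P i)) := by
  classical
  refine (hP.ite (fun i => encProp_ne_nil) (.const (encBool false))
    (.const (encBool true))).congr fun i => ?_
  by_cases hi : P i <;> simp [encProp, hi]

theorem Comp.and {P Q : ι → Prop} (hP : Comp sz inp (fun i => encProp (P i)))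
    (hQ : Comp sz inp (fun i => encProp (Q i))) :
    Comp sz inp (fun i => encProp (P i ∧ Q i)) := by
  classical
  refine (hP.ite (fun i => encProp_ne_nil) hQ (.const (encBool false))).congr fun i => ?_
  by_cases hi : P i <;> simp [encProp, hi]

theorem Comp.or {P Q : ι → Prop} (hP : Comp sz inp (fun i => encProp (P i)))
    (hQ : Comp sz inp (fun i => encProp (Q i))) :
    Comp sz inp (fun i => encProp (P i ∨ Q i)) := by
  classical
  refine (hP.ite (fun i => encProp_ne_nil) (.const (encBool true)) hQ).congr fun i => ?_
  by_cases hi : P i <;> simp [encProp, hi]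

theorem Comp.prop_congr {P Q : ι → Prop} (hP : Comp sz inp (fun i => encProp (P i)))
    (h : ∀ i, P i ↔ Q i) : Comp sz inp (fun i => encProp (Q i)) :=
  hP.congr fun i => by rw [propext (h i)]

end

/-! ## Arithmetic in unary and lists -/

section
variable {ι : Type} {sz : ι → ℕ} {inp : ι → Data}

/-- Weakening: the body of a loop or table sees an enlarged context and may ignore the new
component. -/
theorem Comp.under {κ : Type} {f : ι → Data} (hf : Comp sz inp f) (u : κ → ι) {y : κ → Data} :
    Comp (fun x => sz (u x)) (fun x => .cons (inp (u x)) (y x)) (fun x => f (u x)) :=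
  Comp.id.fst.comp (hf.reindex u)

/-- Polynomially bounded natural numbers that are computable in polynomial time in unary. -/
structure CompN (sz : ι → ℕ) (inp : ι → Data) (f : ι → ℕ) : Prop where
  bdd : PolyBdd sz f
  comp : Comp sz inp (fun i => encNat (f i))

variable {f g : ι → ℕ}

theorem CompN.under {κ : Type} (hf : CompN sz inp f) (u : κ → ι) {y : κ → Data} :
    CompN (fun x => sz (u x)) (fun x => .cons (inp (u x)) (y x)) (fun x => f (u x)) :=
  ⟨hf.bdd.reindex u fun _ => le_rfl, hf.comp.under u⟩

theorem CompN.congr (hf : CompN sz inp f) (h : ∀ i, f i = g i) : CompN sz inp g :=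
  (funext h : f = g) ▸ hf

theorem CompN.const (c : ℕ) : CompN sz inp (fun _ => c) := ⟨.const c, .const _⟩

/-- The loop index, in the context of the body of a loop. -/
theorem CompN.index (hf : PolyBdd sz f) {y : (i : ι) × Fin (f i) → Data} :
    CompN (fun x : (i : ι) × Fin (f i) => sz x.1)
      (fun x => .cons (inp x.1) (.cons (encNat x.2) (y x))) (fun x => (x.2 : ℕ)) :=
  ⟨(hf.reindex Sigma.fst fun _ => le_rfl).mono fun x => x.2.2.le, Comp.id.snd.fst⟩

/-- The index, in the context of an entry of a table. -/
theorem CompN.last (hf : PolyBdd sz f) :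
    CompN (fun x : (i : ι) × Fin (f i) => sz x.1)
      (fun x => .cons (inp x.1) (encNat x.2)) (fun x => (x.2 : ℕ)) :=
  ⟨(hf.reindex Sigma.fst fun _ => le_rfl).mono fun x => x.2.2.le, Comp.id.snd⟩

theorem CompN.succ (hf : CompN sz inp f) : CompN sz inp (fun i => f i + 1) :=
  ⟨hf.bdd.add (.const 1), Comp.nil.cons hf.comp⟩

theorem CompN.add (hf : CompN sz inp f) (hg : CompN sz inp g) :
    CompN sz inp (fun i => f i + g i) :=
  ⟨hf.bdd.add hg.bdd, Comp.natRec (s := fun i k => encNat (f i + k)) hg.bdd hg.comp hf.comp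
    (Comp.nil.cons Comp.id.snd.snd)⟩

theorem CompN.mul (hf : CompN sz inp f) (hg : CompN sz inp g) :
    CompN sz inp (fun i => f i * g i) := by
  refine ⟨hf.bdd.mul hg.bdd, Comp.natRec (s := fun i k => encNat (f i * k)) hg.bdd hg.comp
    .nil ?_⟩
  have h1 : CompN (fun x : (i : ι) × Fin (g i) => sz x.1)
      (fun x => .cons (inp x.1) (.cons (encNat x.2) (encNat (f x.1 * x.2))))
      (fun x => f x.1 * x.2) :=
    ⟨((hf.bdd.mul hg.bdd).reindex Sigma.fst fun _ => le_rfl).mono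
      fun x => Nat.mul_le_mul_left _ x.2.2.le, Comp.id.snd.snd⟩
  exact (h1.add (hf.under Sigma.fst)).comp

theorem CompN.pow (hf : CompN sz inp f) (c : ℕ) : CompN sz inp (fun i => f i ^ c) := by
  induction c with
  | zero => simpa using CompN.const 1
  | succ c ih => simpa only [pow_succ] using ih.mul hf

theorem Comp.iterate_tail {d : ι → Data} (hd : Comp sz inp d) (hf : CompN sz inp f) :
    Comp sz inp (fun i => Data.tail^[f i] (d i)) :=
  Comp.natRec (s := fun i k => Data.tail^[k] (d i)) hf.bdd hf.comp hd
    ((Comp.id.snd.snd.tail).congr fun x => by rw [Function.iterate_succ_apply'])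

theorem iterate_tail_encNat (a b : ℕ) : Data.tail^[b] (encNat a) = encNat (a - b) := by
  induction b with
  | zero => rfl
  | succ b ih =>
    rw [Function.iterate_succ_apply', ih]
    rcases h : a - b with _ | c
    · rw [show a - (b + 1) = 0 by omega]; rfl
    · rw [show a - (b + 1) = c by omega]; rfl

/-- Truncated subtraction is iterated `tail`. It reduces every comparison of numbers to the test for
`nil`. -/
theorem CompN.sub (hf : CompN sz inp f) (hg : CompN sz inp g) :
    CompN sz inp (fun i => f i - g i) :=
  ⟨hf.bdd.mono fun _ => Nat.sub_le _ _,
    (hf.comp.iterate_tail hg).congr fun _ => iterate_tail_encNat _ _⟩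

theorem CompN.lt (hf : CompN sz inp f) (hg : CompN sz inp g) :
    Comp sz inp (fun i => encProp (f i < g i)) :=
  (hg.sub hf).comp.prop fun i => by rw [encNat_ne_nil]; omega

theorem CompN.le (hf : CompN sz inp f) (hg : CompN sz inp g) :
    Comp sz inp (fun i => encProp (f i ≤ g i)) :=
  (hf.lt hg.succ).prop_congr fun _ => Nat.lt_succ_iff

theorem CompN.eq (hf : CompN sz inp f) (hg : CompN sz inp g) :
    Comp sz inp (fun i => encProp (f i = g i)) :=
  ((hf.le hg).and (hg.le hf)).prop_congr fun i => by omega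

theorem iterate_tail_encList (l : List Data) (k : ℕ) :
    Data.tail^[k] (encList l) = encList (l.drop k) := by
  induction k generalizing l with
  | zero => rfl
  | succ k ih =>
    rw [Function.iterate_succ_apply]
    cases l with
    | nil => simpa [encList, Data.tail] using ih []
    | cons a l => exact ih l

theorem head_encList_drop (l : List Data) (k : ℕ) (h : k < l.length) :
    (encList (l.drop k)).head = l[k] := by
  rw [List.drop_eq_getElem_cons h]; rfl

theorem Comp.nth {q : ι → ℕ} {a : ∀ i, Fin (q i) → Data} {k : ∀ i, Fin (q i)}
    (ha : Comp sz inp (fun i => encList (List.ofFn (a i))))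
    (hk : CompN sz inp (fun i => (k i : ℕ))) : Comp sz inp (fun i => a i (k i)) :=
  (ha.iterate_tail hk).head.congr fun i => by
    rw [iterate_tail_encList, head_encList_drop _ _ (by simp)]
    simp

/-- Lists grow at the front, so after `k` rounds the accumulator holds the last `k` entries and the
next one has index `rev k`. -/
theorem Comp.ofFn {a : ∀ i, Fin (f i) → Data} (hf : CompN sz inp f)
    (ha : Comp (fun x : (i : ι) × Fin (f i) => sz x.1)
      (fun x => .cons (inp x.1) (encNat x.2)) (fun x => a x.1 x.2)) :
    Comp sz inp (fun i => encList (List.ofFn (a i))) := by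
  have h := Comp.natRec (sz := sz) (inp := inp)
    (s := fun i k => encList ((List.ofFn (a i)).drop (f i - k))) hf.bdd hf.comp
    (Comp.nil.congr fun i => by
      rw [Nat.sub_zero, List.drop_of_length_le (by simp)]; rfl) ?_
  · simpa using h
  have hr := ha.reindex (fun x : (i : ι) × Fin (f i) => ⟨x.1, x.2.rev⟩)
  have h1 : Comp (fun x : (i : ι) × Fin (f i) => sz x.1)
      (fun x => .cons (inp x.1) (.cons (encNat x.2)
        (encList ((List.ofFn (a x.1)).drop (f x.1 - x.2)))))
      (fun x => .cons (inp x.1) (encNat x.2.rev)) :=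
    Comp.id.fst.cons
      (((hf.under Sigma.fst).sub (CompN.index hf.bdd).succ).comp.congr fun x => by
        rw [Fin.val_rev])
  refine ((h1.comp hr).cons Comp.id.snd.snd).congr fun x => ?_
  have hx := x.2.2
  rw [show f x.1 - (x.2 + 1 : ℕ) = (x.2.rev : ℕ) by rw [Fin.val_rev],
    List.drop_eq_getElem_cons (i := (x.2.rev : ℕ)) (by simp [x.2.pos]),
    show (x.2.rev : ℕ) + 1 = f x.1 - x.2 by rw [Fin.val_rev]; omega]
  simp only [encList, List.getElem_ofFn]

theorem CompN.card {P : ∀ i, Fin (f i) → Prop} [∀ i, DecidablePred (P i)] (hf : CompN sz inp f)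
    (hP : Comp (fun x : (i : ι) × Fin (f i) => sz x.1)
      (fun x => .cons (inp x.1) (encNat x.2)) (fun x => encProp (P x.1 x.2))) :
    CompN sz inp (fun i => (Finset.univ.filter (P i)).card) := by
  refine ⟨hf.bdd.mono fun i => (Finset.card_le_univ _).trans (by simp), ?_⟩
  have h := Comp.natRec (sz := sz) (inp := inp)
    (s := fun i k => encNat (Finset.univ.filter fun x : Fin (f i) => (x : ℕ) < k ∧ P i x).card)
    hf.bdd hf.comp (Comp.nil.congr fun i => by simp [encNat]) ?_
  · simpa using h
  have h1 : Comp (fun x : (i : ι) × Fin (f i) => sz x.1)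
      (fun x => .cons (inp x.1) (.cons (encNat x.2)
        (encNat (Finset.univ.filter fun y : Fin (f x.1) => (y : ℕ) < x.2 ∧ P x.1 y).card)))
      (fun x => .cons (inp x.1) (encNat x.2)) := Comp.id.fst.cons Comp.id.snd.fst
  refine ((h1.comp hP).ite (fun _ => encProp_ne_nil) (Comp.nil.cons Comp.id.snd.snd)
    Comp.id.snd.snd).congr fun x => ?_
  obtain ⟨i, k⟩ := x
  dsimp only
  by_cases h : P i k
  · rw [if_pos h, show (Finset.univ.filter fun y : Fin (f i) => (y : ℕ) < k + 1 ∧ P i y) =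
      insert k (Finset.univ.filter fun y : Fin (f i) => (y : ℕ) < k ∧ P i y) by
        ext y; simp only [Finset.mem_filter, Finset.mem_univ, true_and, Finset.mem_insert]
        constructor
        · rintro ⟨h1, h2⟩
          rcases Nat.lt_succ_iff_lt_or_eq.1 h1 with h3 | h3
          · exact .inr ⟨h3, h2⟩
          · exact .inl (Fin.ext h3)
        · rintro (rfl | ⟨h1, h2⟩)
          · exact ⟨Nat.lt_succ_self _, h⟩
          · exact ⟨by omega, h2⟩,
      Finset.card_insert_of_notMem (by simp)]
    rfl
  · rw [if_neg h]
    congr 2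
    ext y; simp only [Finset.mem_filter, Finset.mem_univ, true_and]
    constructor
    · rintro ⟨h1, h2⟩; exact ⟨by omega, h2⟩
    · rintro ⟨h1, h2⟩
      refine ⟨lt_of_le_of_ne (by omega) fun h3 => h ?_, h2⟩
      rwa [← Fin.ext h3]

theorem Comp.exists {P : ∀ i, Fin (f i) → Prop} (hf : CompN sz inp f)
    (hP : Comp (fun x : (i : ι) × Fin (f i) => sz x.1)
      (fun x => .cons (inp x.1) (encNat x.2)) (fun x => encProp (P x.1 x.2))) :
    Comp sz inp (fun i => encProp (∃ k, P i k)) := by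
  classical
  exact (hf.card hP).comp.prop fun i => by
    rw [encNat_ne_nil, Finset.card_ne_zero]; simp [Finset.filter_nonempty_iff]

/-- The quotient is the number of `k < f` with `(k + 1) * g ≤ f`. -/
theorem CompN.div (hf : CompN sz inp f) (hg : CompN sz inp g) (h0 : ∀ i, 0 < g i) :
    CompN sz inp (fun i => f i / g i) := by
  classical
  have h := CompN.card (P := fun i (k : Fin (f i)) => (k + 1) * g i ≤ f i) hf
    (((CompN.last hf.bdd).succ.mul (hg.under Sigma.fst)).le (hf.under Sigma.fst))
  refine h.congr fun i => ?_
  have hc : ∀ k : Fin (f i), (k + 1) * g i ≤ f i ↔ (k : ℕ) < f i / g i := fun k => by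
    rw [← Nat.le_div_iff_mul_le (h0 i), Nat.succ_le_iff]
  simp only [hc, Fin.card_filter_val_lt]
  exact min_eq_right (Nat.div_le_self _ _)

theorem CompN.mod (hf : CompN sz inp f) (hg : CompN sz inp g) (h0 : ∀ i, 0 < g i) :
    CompN sz inp (fun i => f i % g i) :=
  (hf.sub (hg.mul (hf.div hg h0))).congr fun i => by
    have := Nat.div_add_mod (f i) (g i); omega

end

/-! ## From constraints to examples -/

/-- A sign, as an element of `{-1, 0, 1}`. -/
def unitSign (u : ℤˣ) : SignType := if u = 1 then 1 else -1

/-- The signs of the literals of `C`, where the sign of the first literal is replaced by `1`. -/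
def KTuple.normSign {n K : ℕ} (C : KTuple n K) (i : Fin K) : ℤˣ :=
  if (i : ℕ) = 0 then 1 else C.2 i

/-- The sign of the variable `a` in the first `k` literals of the normalized tuple, `0` if it does
not occur there. -/
def KTuple.vecUpto {n K : ℕ} (C : KTuple n K) (a : Fin n) : ℕ → SignType
  | 0 => 0
  | k + 1 => if h : k < K then
      if C.1 ⟨k, h⟩ = a then unitSign (C.normSign ⟨k, h⟩) else C.vecUpto a k
    else C.vecUpto a k

/-- The normalized tuple as a vector in `{-1, 0, 1}^n`. -/
def KTuple.vec {n K : ℕ} (C : KTuple n K) (a : Fin n) : SignType := C.vecUpto a K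

/-- The coordinates of the `D`-th tensor power of `v`. -/
def tensorPow {l : ℕ} (v : Fin l → SignType) : ∀ D : ℕ, Fin (l ^ D) → SignType
  | 0, _ => 1
  | D + 1, x => tensorPow v D (Fin.divNat (m := l ^ D) (n := l) x) *
      v (Fin.modNat (m := l ^ D) (n := l) x)

/-- The example of the learning problem that belongs to a constraint. -/
def KTuple.toExample {n K : ℕ} [NeZero K] (D : ℕ) (C : KTuple n K) : Example ((n + 1) ^ D) :=
  (tensorPow (Fin.cons 1 C.vec) D, C.2 0)

/-- The number with binary digits `f`, most significant digit first, modulo `m`. -/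
def binMod {n : ℕ} (m : ℕ) (f : Fin n → Bool) : ℕ → ℕ
  | 0 => 0
  | t + 1 => (2 * binMod m f t + if h : t < n then (f ⟨t, h⟩).toNat else 0) % m

theorem binMod_lt {n m : ℕ} (hm : 0 < m) (f : Fin n → Bool) (t : ℕ) : binMod m f t < m := by
  cases t with
  | zero => exact hm
  | succ t => exact Nat.mod_lt _ hm

/-- A nearly uniform element of `Fin m`, made from `n` bits. -/
def pick {n m : ℕ} (hm : 0 < m) (f : Fin n → Bool) : Fin m := ⟨binMod m f n, binMod_lt hm f n⟩

open Classical in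
/-- The number of constraints in which the variables `a` and `b` have sign product `s`. -/
noncomputable def pairCount {n K m : ℕ} (J : KFormula n K m) (a b : Fin n) (s : SignType) : ℕ :=
  (Finset.univ.filter fun j => (J j).vec a * (J j).vec b = s).card

/-- For every two variables, the two sign products are about equally frequent. -/
def Balanced {n K m : ℕ} (t : ℕ) (J : KFormula n K m) : Prop :=
  ¬ ∃ a b : Fin n, ¬ a = b ∧ (pairCount J a b (-1) + t < pairCount J a b 1 ∨
    pairCount J a b 1 + t < pairCount J a b (-1))

open Classical in
/-- The number of constraints on which the hypothesis `h` is correct. -/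
noncomputable def numCorrect {n K m : ℕ} [NeZero K] {D : ℕ} (J : KFormula n K m)
    (h : Inst ((n + 1) ^ D) → ℤˣ) : ℕ :=
  (Finset.univ.filter fun j => h ((J j).toExample D).1 = ((J j).toExample D).2).card

/-- The number of examples, and of coins, that the learning rule uses for the constraints over
`n` variables. -/
abbrev numEx (b D n : ℕ) : ℕ := ((n + 1) ^ D) ^ b + b

/-- The hypothesis learnt from examples of `J` chosen by the coins `u`. -/
def trialHyp {b n K m : ℕ} [NeZero K] (H : LearningRule b) (D : ℕ) (hm : 0 < m)
    (J : KFormula n K m) (u : Fin (numEx b D n) → Fin (n + 1) → Bool) :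
    Inst ((n + 1) ^ D) → ℤˣ :=
  H ((n + 1) ^ D) (fun s => (J (pick hm fun t : Fin n => u s t.castSucc)).toExample D)
    (fun s => u s (Fin.last n))

theorem coin_lt {n q T : ℕ} (hT : n * q * (n + 1) ≤ T) (ρ : Fin n) (s : Fin q)
    (t : Fin (n + 1)) : (ρ * q + s) * (n + 1) + t < T := by
  have h1 : (ρ * q + s : ℕ) + 1 ≤ n * q := by
    have : ((ρ : ℕ) + 1) * q ≤ n * q := Nat.mul_le_mul_right _ ρ.2
    have := s.2
    linarith
  have h2 : ((ρ * q + s : ℕ) + 1) * (n + 1) ≤ n * q * (n + 1) := Nat.mul_le_mul_right _ h1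
  have := t.2
  linarith

/-- The arrangement of the coins: one row of `q` records of `n + 1` bits for each trial. -/
def coinIndex {n q T : ℕ} (hT : n * q * (n + 1) ≤ T) (x : Fin n × Fin q × Fin (n + 1)) : Fin T :=
  ⟨(x.1 * q + x.2.1) * (n + 1) + x.2.2, coin_lt hT x.1 x.2.1 x.2.2⟩

/-- The distinguisher says "non-random". -/
def Accept {b n K κ : ℕ} [NeZero K] (H : LearningRule b) (D n₀ e : ℕ) (J : KFormula n K (n ^ κ))
    (u : Fin n × Fin (numEx b D n) × Fin (n + 1) → Bool) : Prop :=
  n < n₀ ∨ ¬ Balanced (n ^ (κ - 2)) J ∨ ∃ ρ : Fin n, n ^ κ + n ^ (κ - e) ≤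
    2 * numCorrect J (trialHyp H D (Nat.pow_pos ρ.pos) J fun s t => u (ρ, s, t))

/-! ## The distinguisher as a program -/

section
variable {ι : Type} {sz : ι → ℕ} {inp : ι → Data}

theorem encUnit_ne_nil {u : ℤˣ} : encUnit u ≠ .nil ↔ u = 1 := by
  by_cases h : u = 1 <;> simp [encUnit, h]

theorem encSign_ne_nil {s : SignType} : encSign s ≠ .nil ↔ s ≠ 0 := by
  cases s <;> simp [encSign]

theorem head_encSign_ne_nil {s : SignType} : (encSign s).head ≠ .nil ↔ s = -1 := by
  cases s <;> simp [encSign, Data.head]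

theorem Comp.unit_eq_one {f : ι → ℤˣ} (hf : Comp sz inp (fun i => encUnit (f i))) :
    Comp sz inp (fun i => encProp (f i = 1)) :=
  hf.prop fun _ => encUnit_ne_nil

theorem Comp.unit_eq {f g : ι → ℤˣ} (hf : Comp sz inp (fun i => encUnit (f i)))
    (hg : Comp sz inp (fun i => encUnit (g i))) :
    Comp sz inp (fun i => encProp (f i = g i)) := by
  refine ((hf.unit_eq_one.and hg.unit_eq_one).or
    (hf.unit_eq_one.not.and hg.unit_eq_one.not)).prop_congr fun i => ?_
  rcases Int.units_eq_one_or (f i) with h | h <;> rcases Int.units_eq_one_or (g i) with h' | h' <;>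
    simp [h, h']

theorem Comp.unitSign {f : ι → ℤˣ} (hf : Comp sz inp (fun i => encUnit (f i))) :
    Comp sz inp (fun i => encSign (unitSign (f i))) := by
  refine (hf.ite (fun _ => encUnit_ne_nil) (.const (encSign 1)) (.const (encSign (-1)))).congr
    fun i => ?_
  by_cases h : f i = 1 <;> simp [XorHalf.unitSign, h]

theorem Comp.sign_ne_zero {f : ι → SignType} (hf : Comp sz inp (fun i => encSign (f i))) :
    Comp sz inp (fun i => encProp (f i ≠ 0)) := hf.prop fun _ => encSign_ne_nil

theorem Comp.sign_eq_neg_one {f : ι → SignType} (hf : Comp sz inp (fun i => encSign (f i))) :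
    Comp sz inp (fun i => encProp (f i = -1)) := hf.head.prop fun _ => head_encSign_ne_nil

theorem Comp.sign_eq_one {f : ι → SignType} (hf : Comp sz inp (fun i => encSign (f i))) :
    Comp sz inp (fun i => encProp (f i = 1)) :=
  (hf.sign_ne_zero.and hf.sign_eq_neg_one.not).prop_congr fun i => by
    cases f i <;> decide

theorem Comp.sign_mul {f g : ι → SignType} (hf : Comp sz inp (fun i => encSign (f i)))
    (hg : Comp sz inp (fun i => encSign (g i))) :
    Comp sz inp (fun i => encSign (f i * g i)) := by
  have hneg : Comp sz inp (fun i => encSign (-g i)) := by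
    refine (hg.sign_ne_zero.ite (fun _ => encProp_ne_nil)
      (hg.sign_eq_neg_one.ite (fun _ => encProp_ne_nil) (.const (encSign 1))
        (.const (encSign (-1)))) (.const (encSign 0))).congr fun i => ?_
    generalize g i = s
    cases s <;> rfl
  refine (hf.sign_ne_zero.ite (fun _ => encProp_ne_nil)
      (hf.sign_eq_neg_one.ite (fun _ => encProp_ne_nil) hneg hg) (.const (encSign 0))).congr
    fun i => ?_
  generalize f i = s
  generalize g i = t
  cases s <;> cases t <;> rfl

theorem Comp.vec {K : ℕ} {n : ι → ℕ} {C : ∀ i, KTuple (n i) K} (hn : CompN sz inp n)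
    (hC : Comp sz inp (fun i => encKTuple (C i))) :
    Comp sz inp (fun i => encInst (C i).vec) := by
  refine Comp.ofFn hn (Comp.natRec (q := fun _ => K)
    (s := fun (x : (i : ι) × Fin (n i)) k => encSign ((C x.1).vecUpto x.2 k)) (.const K) (.const _)
    (.const (encSign 0)) ?_)
  have hk := CompN.index (sz := fun x : (i : ι) × Fin (n i) => sz x.1)
    (inp := fun x : (i : ι) × Fin (n i) => .cons (inp x.1) (encNat x.2))
    (f := fun _ => K)
    (y := fun x : (_ : (i : ι) × Fin (n i)) × Fin K =>
      encSign ((C x.1.1).vecUpto x.1.2 x.2)) (.const K)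
  have hl := Comp.nth (q := fun _ => K)
    (k := fun x : (_ : (i : ι) × Fin (n i)) × Fin K => x.2) ((hC.under (Sigma.fst : (i : ι) × Fin (n i) → ι)
    (y := fun x => encNat x.2)).under (Sigma.fst : (_ : (i : ι) × Fin (n i)) × Fin K → _)
    (y := fun x => .cons (encNat x.2) (encSign ((C x.1.1).vecUpto x.1.2 x.2)))) hk
  have hv : CompN _ _ fun x : (_ : (i : ι) × Fin (n i)) × Fin K => ((C x.1.1).1 x.2 : ℕ) :=
    ⟨(hn.bdd.reindex (fun x : (_ : (i : ι) × Fin (n i)) × Fin K => x.1.1)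
      fun _ => le_rfl).mono fun x => ((C x.1.1).1 x.2).2.le, hl.fst⟩
  have ha := (CompN.last (inp := inp) hn.bdd).under
    (Sigma.fst : (_ : (i : ι) × Fin (n i)) × Fin K → _)
    (y := fun x : (_ : (i : ι) × Fin (n i)) × Fin K => .cons (encNat x.2) (encSign ((C x.1.1).vecUpto x.1.2 x.2)))
  have h0 := hk.eq (.const 0)
  refine ((hv.eq ha).ite (fun _ => encProp_ne_nil)
    (h0.ite (fun _ => encProp_ne_nil) (.const (encSign 1)) hl.snd.unitSign)
    Comp.id.snd.snd).congr fun ⟨⟨i, a⟩, k⟩ => ?_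
  simp only [KTuple.vecUpto, k.2, dif_pos, KTuple.normSign, Fin.eta, Fin.val_inj]
  by_cases h1 : (C i).1 k = a <;> by_cases h2 : (k : ℕ) = 0 <;> simp [h1, h2, XorHalf.unitSign]

theorem Comp.tensorPow {l : ι → ℕ} {v : ∀ i, Fin (l i) → SignType} (hl : CompN sz inp l)
    (h0 : ∀ i, 0 < l i) (hv : Comp sz inp (fun i => encInst (v i))) (D : ℕ) :
    Comp sz inp (fun i => encInst (tensorPow (v i) D)) := by
  induction D with
  | zero =>
    refine (Comp.const (encInst fun _ : Fin 1 => (1 : SignType))).congr fun i => ?_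
    rfl
  | succ D ih =>
    refine Comp.ofFn (hl.pow (D + 1)) ?_
    have hx := CompN.last (inp := inp) (hl.pow (D + 1)).bdd
    have hl' := hl.under (Sigma.fst : (i : ι) × Fin (l i ^ (D + 1)) → ι)
      (y := fun x => encNat x.2)
    have hd := hx.div hl' fun _ => h0 _
    have hm := hx.mod hl' fun _ => h0 _
    exact (Comp.nth (k := fun x : (i : ι) × Fin (l i ^ (D + 1)) => Fin.divNat (m := l x.1 ^ D) (n := l x.1) x.2)
        (ih.under Sigma.fst) hd).sign_mul
      (Comp.nth (k := fun x : (i : ι) × Fin (l i ^ (D + 1)) => Fin.modNat (m := l x.1 ^ D) (n := l x.1) x.2)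
        (hv.under Sigma.fst) hm)

theorem Comp.toExample_fst {K : ℕ} [NeZero K] {n : ι → ℕ} {C : ∀ i, KTuple (n i) K}
    (hn : CompN sz inp n) (hC : Comp sz inp (fun i => encKTuple (C i))) (D : ℕ) :
    Comp sz inp (fun i => encInst ((C i).toExample D).1) := by
  refine Comp.tensorPow (v := fun i => Fin.cons 1 (C i).vec) hn.succ (fun _ => Nat.succ_pos _)
    (((Comp.const (encSign 1)).cons (Comp.vec hn hC)).congr fun i => ?_) D
  simp [encInst, List.ofFn_succ, encList]

theorem Comp.toExample_snd {K : ℕ} [NeZero K] {n : ι → ℕ} {C : ∀ i, KTuple (n i) K}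
    (hC : Comp sz inp (fun i => encKTuple (C i))) (D : ℕ) :
    Comp sz inp (fun i => encUnit ((C i).toExample D).2) :=
  (Comp.nth (q := fun _ => K) (k := fun _ => 0) hC (.const 0)).snd

/-- Reducing modulo `m` after each digit keeps the unary accumulator below `m`; the unreduced number
can be exponential in `n`. -/
theorem CompN.pick {n m : ι → ℕ} {f : ∀ i, Fin (n i) → Bool} (hm0 : ∀ i, 0 < m i)
    (hn : CompN sz inp n) (hm : CompN sz inp m)
    (hf : Comp (fun x : (i : ι) × Fin (n i) => sz x.1)
      (fun x => .cons (inp x.1) (encNat x.2)) (fun x => encBool (f x.1 x.2))) :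
    CompN sz inp (fun i => (pick (hm0 i) (f i) : ℕ)) := by
  refine ⟨hm.bdd.mono fun i => (XorHalf.pick (hm0 i) (f i)).2.le, Comp.natRec
    (s := fun i k => encNat (binMod (m i) (f i) k)) hn.bdd hn.comp .nil ?_⟩
  have hp : CompN (fun x : (i : ι) × Fin (n i) => sz x.1)
      (fun x => .cons (inp x.1) (.cons (encNat x.2) (encNat (binMod (m x.1) (f x.1) x.2))))
      (fun x => binMod (m x.1) (f x.1) x.2) :=
    ⟨(hm.bdd.reindex Sigma.fst fun _ => le_rfl).mono fun x => (binMod_lt (hm0 _) _ _).le,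
      Comp.id.snd.snd⟩
  have hb : CompN (fun x : (i : ι) × Fin (n i) => sz x.1)
      (fun x => .cons (inp x.1) (.cons (encNat x.2) (encNat (binMod (m x.1) (f x.1) x.2))))
      (fun x => (f x.1 x.2).toNat) :=
    ⟨(PolyBdd.const 1).mono fun x => Bool.toNat_le _,
      ((Comp.id.fst.cons Comp.id.snd.fst).comp hf).congr fun x => by
        cases f x.1 x.2 <;> rfl⟩
  refine (((CompN.const 2).mul hp).add hb).mod (hm.under Sigma.fst) (fun _ => hm0 _) |>.comp.congr
    fun x => ?_
  simp [binMod]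

end

/-- A formula together with sufficiently many coins. -/
structure XorInput (K κ b D : ℕ) where
  /-- the number of variables -/
  n : ℕ
  /-- the formula -/
  J : KFormula n K (n ^ κ)
  /-- the number of coins -/
  T : ℕ
  /-- the coins -/
  r : Fin T → Bool
  enough : n * numEx b D n * (n + 1) ≤ T

section
variable {K κ b D : ℕ} {ι : Type} {i : ι → XorInput K κ b D} {inp : ι → Data}

/-- The coins of an input, arranged in records. -/
def XorInput.coins (i : XorInput K κ b D) (x : Fin i.n × Fin (numEx b D i.n) × Fin (i.n + 1)) :
    Bool := i.r (coinIndex i.enough x)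

/-- The formula and the coins are available in the context. -/
abbrev Reads (i : ι → XorInput K κ b D) (inp : ι → Data) : Prop :=
  Comp (fun x => (i x).n) inp (fun x => encXorInput (i x).J (i x).r)

theorem Reads.n (h : Reads i inp) : CompN (fun x => (i x).n) inp (fun x => (i x).n) :=
  ⟨.self, h.fst⟩

theorem Reads.numEx (h : Reads i inp) :
    CompN (fun x => (i x).n) inp (fun x => numEx b D (i x).n) :=
  ((h.n.succ.pow D).pow b).add (.const b)

theorem Reads.tuple (h : Reads i inp) {j : ∀ x, Fin ((i x).n ^ κ)}
    (hj : CompN (fun x => (i x).n) inp (fun x => (j x : ℕ))) :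
    Comp (fun x => (i x).n) inp (fun x => encKTuple ((i x).J (j x))) :=
  Comp.nth (a := fun x j => encKTuple ((i x).J j)) h.snd.fst hj

theorem Reads.coin (h : Reads i inp) {ρ : ∀ x, Fin (i x).n} {s : ∀ x, Fin (XorHalf.numEx b D (i x).n)}
    {t : ∀ x, Fin ((i x).n + 1)} (hρ : CompN (fun x => (i x).n) inp (fun x => (ρ x : ℕ)))
    (hs : CompN (fun x => (i x).n) inp (fun x => (s x : ℕ)))
    (ht : CompN (fun x => (i x).n) inp (fun x => (t x : ℕ))) :
    Comp (fun x => (i x).n) inp (fun x => encBool ((i x).coins (ρ x, s x, t x))) :=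
  Comp.nth (a := fun x j => encBool ((i x).r j))
    (k := fun x => coinIndex (i x).enough (ρ x, s x, t x)) h.snd.snd
    ((((hρ.mul h.numEx).add hs).mul h.n.succ).add ht)

theorem Reads.learnInput [NeZero K] (h : Reads i inp) {ρ : ∀ x, Fin (i x).n}
    (hρ : CompN (fun x => (i x).n) inp (fun x => (ρ x : ℕ))) :
    Comp (fun x => (i x).n) inp (fun x => encLearnInput
      (fun s : Fin (XorHalf.numEx b D (i x).n) => ((i x).J (pick (Nat.pow_pos (ρ x).pos)
        fun t : Fin (i x).n => (i x).coins (ρ x, s, t.castSucc))).toExample D)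
      (fun s => (i x).coins (ρ x, s, Fin.last (i x).n))) := by
  have hY : Reads (fun y : (x : ι) × Fin (XorHalf.numEx b D (i x).n) => i y.1)
    (fun y => .cons (inp y.1) (encNat y.2)) := h.under Sigma.fst
  have hYs := CompN.last (inp := inp) h.numEx.bdd
  have hYρ := hρ.under (Sigma.fst : (x : ι) × Fin (XorHalf.numEx b D (i x).n) → ι)
    (y := fun y => encNat y.2)
  refine (h.n.succ.pow D).comp.cons ((Comp.ofFn h.numEx ?_).cons (Comp.ofFn h.numEx ?_))
  · have hZ : Reads (fun z : (y : (x : ι) × Fin (XorHalf.numEx b D (i x).n)) × Fin (i y.1).n =>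
        i z.1.1) (fun z => .cons (.cons (inp z.1.1) (encNat z.1.2)) (encNat z.2)) :=
      hY.under Sigma.fst
    have hp := CompN.pick (sz := fun y : (x : ι) × Fin (XorHalf.numEx b D (i x).n) => (i y.1).n)
      (inp := fun y => .cons (inp y.1) (encNat y.2))
      (m := fun y => (i y.1).n ^ κ)
      (f := fun y (t : Fin (i y.1).n) => (i y.1).coins (ρ y.1, y.2, t.castSucc))
      (fun y => Nat.pow_pos (ρ y.1).pos) hY.n (hY.n.pow κ)
      (hZ.coin (ρ := fun z => ρ z.1.1) (s := fun z => z.1.2) (t := fun z => z.2.castSucc)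
        (hYρ.under Sigma.fst) (hYs.under Sigma.fst)
        (CompN.last (inp := fun y : (x : ι) × Fin (XorHalf.numEx b D (i x).n) =>
          .cons (inp y.1) (encNat y.2)) hY.n.bdd))
    have ht := hY.tuple hp
    exact (Comp.toExample_fst hY.n ht D).cons (Comp.toExample_snd ht D)
  · exact hY.coin (ρ := fun y => ρ y.1) (s := fun y => y.2) (t := fun y => Fin.last (i y.1).n)
      hYρ hYs hY.n

/-- One run of the learner gives a description, which is then evaluated on each of the `n ^ κ`
constraints. The learner's time bounds refer to dimension `(n + 1) ^ D`, which is polynomial in `n`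
because `D` is constant. -/
theorem Reads.numCorrect [NeZero K] (h : Reads i inp) {H : LearningRule b} (hH : Efficient H)
    {ρ : ∀ x, Fin (i x).n} (hρ : CompN (fun x => (i x).n) inp (fun x => (ρ x : ℕ))) :
    CompN (fun x => (i x).n) inp (fun x => XorHalf.numCorrect (i x).J
      (trialHyp H D (Nat.pow_pos (ρ x).pos) (i x).J fun s t => (i x).coins (ρ x, s, t))) := by
  obtain ⟨L, E, hLE⟩ := hH
  choose d hd using hLE
  let S : ∀ x, Fin (XorHalf.numEx b D (i x).n) → Example (((i x).n + 1) ^ D) := fun x s =>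
    ((i x).J (pick (Nat.pow_pos (ρ x).pos)
        fun t : Fin (i x).n => (i x).coins (ρ x, s, t.castSucc))).toExample D
  let r : ∀ x, Fin (XorHalf.numEx b D (i x).n) → Bool := fun x s =>
    (i x).coins (ρ x, s, Fin.last (i x).n)
  have hdesc : Comp (fun x => (i x).n) inp (fun x => d _ (S x) (r x)) :=
    (h.learnInput hρ).comp ⟨L, _, h.numEx.bdd, fun x => (hd _ (S x) (r x)).1⟩
  refine (h.n.pow κ).card (P := fun x j => trialHyp H D (Nat.pow_pos (ρ x).pos) (i x).J
    (fun s t => (i x).coins (ρ x, s, t)) (((i x).J j).toExample D).1 =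
      (((i x).J j).toExample D).2) ?_
  have hY : Reads (fun y : (x : ι) × Fin ((i x).n ^ κ) => i y.1)
    (fun y => .cons (inp y.1) (encNat y.2)) := h.under Sigma.fst
  have ht := hY.tuple (j := fun y => y.2) (CompN.last (h.n.pow κ).bdd)
  have he : Comp (fun y : (x : ι) × Fin ((i x).n ^ κ) => (i y.1).n)
      (fun y => .cons (d _ (S y.1) (r y.1)) (encInst (((i y.1).J y.2).toExample D).1))
      (fun y => encUnit (H _ (S y.1) (r y.1) (((i y.1).J y.2).toExample D).1)) :=
    ⟨E, _, hY.numEx.bdd, fun y => (hd _ (S y.1) (r y.1)).2 _⟩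
  exact (((hdesc.under Sigma.fst).cons (Comp.toExample_fst hY.n ht D)).comp he).unit_eq
    (Comp.toExample_snd ht D)

theorem Reads.pairCount (h : Reads i inp) {a c : ∀ x, Fin (i x).n}
    (ha : CompN (fun x => (i x).n) inp (fun x => (a x : ℕ)))
    (hc : CompN (fun x => (i x).n) inp (fun x => (c x : ℕ))) :
    CompN (fun x => (i x).n) inp (fun x => XorHalf.pairCount (i x).J (a x) (c x) 1) ∧
    CompN (fun x => (i x).n) inp (fun x => XorHalf.pairCount (i x).J (a x) (c x) (-1)) := by
  have hY : Reads (fun y : (x : ι) × Fin ((i x).n ^ κ) => i y.1)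
    (fun y => .cons (inp y.1) (encNat y.2)) := h.under Sigma.fst
  have hv := Comp.vec hY.n (hY.tuple (j := fun y => y.2) (CompN.last (h.n.pow κ).bdd))
  have hm := (Comp.nth (k := fun y : (x : ι) × Fin ((i x).n ^ κ) => a y.1) hv
    (ha.under Sigma.fst)).sign_mul
    (Comp.nth (k := fun y : (x : ι) × Fin ((i x).n ^ κ) => c y.1) hv (hc.under Sigma.fst))
  exact ⟨(h.n.pow κ).card
      (P := fun x j => ((i x).J j).vec (a x) * ((i x).J j).vec (c x) = 1) hm.sign_eq_one,
    (h.n.pow κ).card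
      (P := fun x j => ((i x).J j).vec (a x) * ((i x).J j).vec (c x) = -1) hm.sign_eq_neg_one⟩

theorem Reads.balanced (h : Reads i inp) (k : ℕ) :
    Comp (fun x => (i x).n) inp (fun x => encProp (Balanced ((i x).n ^ k) (i x).J)) := by
  have hY : Reads (fun y : (x : ι) × Fin (i x).n => i y.1)
    (fun y => .cons (inp y.1) (encNat y.2)) := h.under Sigma.fst
  refine (Comp.exists h.n (Comp.exists hY.n ?_)).not
  have hZ : Reads (fun z : (y : (x : ι) × Fin (i x).n) × Fin (i y.1).n => i z.1.1)
    (fun z => .cons (.cons (inp z.1.1) (encNat z.1.2)) (encNat z.2)) := hY.under Sigma.fst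
  have ha := (CompN.last (inp := inp) h.n.bdd).under
    (Sigma.fst : (y : (x : ι) × Fin (i x).n) × Fin (i y.1).n → _) (y := fun z => encNat z.2)
  have hc := CompN.last (inp := fun y : (x : ι) × Fin (i x).n => .cons (inp y.1) (encNat y.2))
    hY.n.bdd
  obtain ⟨hp, hq⟩ := hZ.pairCount (a := fun z => z.1.2) (c := fun z => z.2) ha hc
  have ht := hZ.n.pow k
  exact ((ha.eq hc).prop_congr fun _ => Fin.val_inj).not.and
    (((hq.add ht).lt hp).or ((hp.add ht).lt hq))

theorem Reads.accept [NeZero K] (h : Reads i inp) {H : LearningRule b} (hH : Efficient H) (n₀ e : ℕ) :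
    Comp (fun x => (i x).n) inp (fun x => encProp (Accept H D n₀ e (i x).J (i x).coins)) := by
  refine (h.n.lt (.const n₀)).or ((h.balanced (κ - 2)).not.or (Comp.exists h.n ?_))
  have hY : Reads (fun y : (x : ι) × Fin (i x).n => i y.1)
    (fun y => .cons (inp y.1) (encNat y.2)) := h.under Sigma.fst
  exact ((hY.n.pow κ).add (hY.n.pow (κ - e))).le
    ((CompN.const 2).mul (hY.numCorrect hH (ρ := fun y => y.2) (CompN.last h.n.bdd)))

end

/-- Some program decides `Accept` within the time and with the number of coins that are allowed
for a polynomial-time algorithm. -/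
theorem exists_prog_accept {K κ b D : ℕ} [NeZero K] {H : LearningRule b} (hH : Efficient H)
    (n₀ e : ℕ) : ∃ (p : Prog) (B : ℕ) (hB : ∀ n : ℕ, n * numEx b D n * (n + 1) ≤ n ^ B + B),
      ∀ n (J : KFormula n K (n ^ κ)) (r : Fin (n ^ B + B) → Bool),
        HaltsWithin p (encXorInput J r)
          (encProp (Accept H D n₀ e J fun x => r (coinIndex (hB n) x))) (n ^ B + B) := by
  -- The family contains every sufficient number `T` of coins, while time is measured in `n` alone.
  -- Program and time bound are thus fixed before `B`, which can then exceed both the running time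
  -- and the demand for coins.
  have hR : Reads (fun i : XorInput K κ b D => i) (fun i => encXorInput i.J i.r) := Comp.id
  obtain ⟨p, t, ht, hp⟩ := hR.accept hH n₀ e
  obtain ⟨B₁, h1⟩ := ht.exists_pow_add
  have hc : PolyBdd (fun n : ℕ => n) (fun n => n * numEx b D n * (n + 1)) :=
    (PolyBdd.self.mul ((((PolyBdd.self.add (.const 1)).pow D).pow b).add (.const b))).mul
      (PolyBdd.self.add (.const 1))
  obtain ⟨B₂, h2⟩ := hc.exists_pow_add
  refine ⟨p, max B₁ B₂, h2 _ (le_max_right _ _), fun n J r => ?_⟩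
  exact (hp ⟨n, J, _, r, h2 _ (le_max_right _ _) n⟩).mono
    (h1 _ (le_max_left _ _) ⟨n, J, _, r, h2 _ (le_max_right _ _) n⟩)

open Finset

/-! ## Uniform probability -/

section
variable {α β : Type} [Fintype α] [Fintype β]

theorem unifProb_def (E : α → Prop) [DecidablePred E] :
    unifProb E = ((univ.filter E).card : ℝ) / (Fintype.card α : ℝ) := by
  unfold unifProb
  congr!

theorem unifProb_nonneg (E : α → Prop) : 0 ≤ unifProb E := by unfold unifProb; positivity

theorem unifProb_mono {E F : α → Prop} (h : ∀ a, E a → F a) : unifProb E ≤ unifProb F := by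
  classical
  unfold unifProb
  gcongr with a
  exact h a

theorem unifProb_or_le (E F : α → Prop) :
    unifProb (fun a => E a ∨ F a) ≤ unifProb E + unifProb F := by
  classical
  simp only [unifProb_def]
  rw [← add_div, filter_or]
  gcongr
  exact_mod_cast card_union_le _ _

theorem unifProb_exists_le {ι : Type} [Fintype ι] (E : ι → α → Prop) :
    unifProb (fun a => ∃ i, E i a) ≤ ∑ i, unifProb (E i) := by
  classical
  unfold unifProb
  rw [← sum_div, ← Nat.cast_sum]
  gcongr
  refine (card_le_card fun a ha => ?_).trans card_biUnion_le
  simpa using ha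

theorem unifProb_not [Nonempty α] (E : α → Prop) :
    unifProb (fun a => ¬ E a) = 1 - unifProb E := by
  classical
  have hpos : (0 : ℝ) < Fintype.card α := by exact_mod_cast Fintype.card_pos
  unfold unifProb
  rw [eq_sub_iff_add_eq, ← add_div, div_eq_one_iff_eq hpos.ne', ← Nat.cast_add, add_comm,
    card_filter_add_card_filter_not, card_univ]

theorem unifProb_bijective {f : α → β} (hf : Function.Bijective f) (E : β → Prop) :
    unifProb (fun a => E (f a)) = unifProb E := by
  classical
  unfold unifProb
  rw [Fintype.card_of_bijective hf]
  congr 2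
  exact card_bij (fun a _ => f a) (by simp) (fun a _ b _ h => hf.1 h) fun b hb => by
    obtain ⟨a, rfl⟩ := hf.2 b
    exact ⟨a, by simpa using hb, rfl⟩

theorem unifProb_fst [Nonempty β] (E : α → Prop) :
    unifProb (fun x : α × β => E x.1) = unifProb E := by
  classical
  have hpos : (0 : ℝ) < Fintype.card β := by exact_mod_cast Fintype.card_pos
  unfold unifProb
  rw [show (univ.filter fun x : α × β => E x.1) = (univ.filter E) ×ˢ univ by ext; simp,
    card_product, Fintype.card_prod, card_univ]
  push_cast
  rw [mul_div_mul_right _ _ hpos.ne']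

/-- The coins outside the range of `e` form an independent factor that does not affect the event. -/
theorem unifProb_comp_injective [DecidableEq α] [DecidableEq β] {e : α → β} (he : Function.Injective e)
    (E : (α → Bool) → Prop) : unifProb (fun r : β → Bool => E (r ∘ e)) = unifProb E := by
  classical
  let Φ : (β → Bool) ≃ (α → Bool) × ({x // x ∉ Set.range e} → Bool) :=
    (Equiv.piEquivPiSubtypeProd (· ∈ Set.range e) fun _ => Bool).trans
      (Equiv.prodCongr ((Equiv.ofInjective e he).symm.arrowCongr (Equiv.refl Bool))
        (Equiv.refl _))
  rw [← unifProb_fst (β := {x // x ∉ Set.range e} → Bool) E, ← unifProb_bijective Φ.bijective]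
  rfl

theorem unifProb_forall (n : ℕ) (E : α → Prop) :
    unifProb (fun u : Fin n → α => ∀ i, E (u i)) = unifProb E ^ n := by
  classical
  simp only [unifProb_def]
  rw [show (univ.filter fun u : Fin n → α => ∀ i, E (u i)) =
      Fintype.piFinset fun _ => univ.filter E by ext; simp, Fintype.card_piFinset]
  simp [div_pow]

theorem unifProb_eq_sum (E : α → Prop) [DecidablePred E] :
    unifProb E = (∑ a, if E a then (1 : ℝ) else 0) / Fintype.card α := by
  unfold unifProb
  rw [sum_boole]
  congr!

/-- Markov's inequality for the conditional probabilities of an event. -/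
theorem unifProb_markov [Nonempty β] (E : α → β → Prop) {p : ℝ}
    (h : ∀ b, unifProb (fun a => E a b) ≤ p) {t : ℝ} (ht : 0 < t) :
    unifProb (fun a => t < unifProb fun b => E a b) ≤ p / t := by
  classical
  have hβ : (0 : ℝ) < Fintype.card β := by exact_mod_cast Fintype.card_pos
  rw [le_div_iff₀ ht, unifProb_eq_sum]
  calc _ = (∑ a, (if t < unifProb fun b => E a b then (1 : ℝ) else 0) * t) / Fintype.card α := by
        rw [← sum_mul]; ring
    _ ≤ (∑ a, unifProb fun b => E a b) / Fintype.card α := by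
        gcongr with a
        split_ifs with h1
        · linarith
        · simpa using unifProb_nonneg _
    _ = (∑ b, unifProb fun a => E a b) / Fintype.card β := by
        simp_rw [unifProb_eq_sum, ← sum_div]
        rw [sum_comm]
        ring
    _ ≤ (∑ _b : β, p) / Fintype.card β := by
        gcongr with b
        exact h b
    _ = p := by rw [sum_const, card_univ, nsmul_eq_mul]; field_simp

/-- Sampling from the image of a uniform distribution. -/
theorem sum_prod_unifProb_mul {X : Type} [Fintype X] (φ : α → X) (q : ℕ)
    (F : (Fin q → X) → ℝ) :
    ∑ S : Fin q → X, (∏ i, unifProb fun a => φ a = S i) * F S =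
      (∑ v : Fin q → α, F (φ ∘ v)) / Fintype.card (Fin q → α) := by
  classical
  rw [← sum_fiberwise (s := univ) (g := fun v : Fin q → α => φ ∘ v), sum_div]
  refine sum_congr rfl fun S _ => ?_
  rw [sum_congr rfl (g := fun _ => F S) fun v hv => by rw [(mem_filter.1 hv).2], sum_const,
    nsmul_eq_mul]
  have h : (univ.filter fun v : Fin q → α => φ ∘ v = S) =
      Fintype.piFinset fun i => univ.filter fun a => φ a = S i := by
    ext v; simp [funext_iff]
  rw [h, Fintype.card_piFinset]
  simp only [unifProb_def, prod_div_distrib, prod_const, card_univ, Fintype.card_fin,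
    Fintype.card_pi]
  push_cast
  ring

/-- Chebyshev's inequality for pairwise uncorrelated bounded variables. -/
theorem unifProb_chebyshev {ι : Type} (s : Finset ι) (Y : ι → α → ℝ) (hY : ∀ j a, |Y j a| ≤ 1)
    (h : ∀ j ∈ s, ∀ k ∈ s, j ≠ k → ∑ a, Y j a * Y k a = 0) {t : ℝ} (ht : 0 < t) :
    unifProb (fun a => t ≤ |∑ j ∈ s, Y j a|) ≤ s.card / t ^ 2 := by
  classical
  rcases isEmpty_or_nonempty α with h0 | h0
  · simp only [unifProb, univ_eq_empty, filter_empty, card_empty]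
    simp only [Nat.cast_zero, zero_div]
    positivity
  have hα : (0 : ℝ) < Fintype.card α := by exact_mod_cast Fintype.card_pos
  rw [le_div_iff₀ (by positivity), unifProb_eq_sum, div_mul_eq_mul_div, div_le_iff₀ hα, sum_mul]
  calc _ ≤ ∑ a, (∑ j ∈ s, Y j a) ^ 2 := by
        refine sum_le_sum fun a _ => ?_
        split_ifs with h1
        · rw [one_mul, ← sq_abs (∑ j ∈ s, Y j a)]; gcongr
        · simpa using sq_nonneg _
    _ = ∑ j ∈ s, ∑ k ∈ s, ∑ a, Y j a * Y k a := by
        simp_rw [sq, sum_mul_sum]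
        rw [sum_comm]
        refine sum_congr rfl fun j _ => sum_comm
    _ = ∑ j ∈ s, ∑ a, Y j a * Y j a := by
        refine sum_congr rfl fun j hj => ?_
        exact sum_eq_single_of_mem j hj fun k hk hkj => h j hj k hk hkj.symm
    _ ≤ ∑ j ∈ s, ∑ _a : α, (1 : ℝ) := by
        refine sum_le_sum fun j _ => sum_le_sum fun a _ => ?_
        rw [← sq, ← sq_abs]
        exact pow_le_one₀ (abs_nonneg _) (hY j a)
    _ = _ := by simp

end

/-! ## The distribution of the sampled index -/

/-- The number with binary digits `f`, most significant digit first. -/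
def binVal {n : ℕ} (f : Fin n → Bool) : ℕ → ℕ
  | 0 => 0
  | t + 1 => 2 * binVal f t + if h : t < n then (f ⟨t, h⟩).toNat else 0

theorem binMod_eq {n : ℕ} (m : ℕ) (f : Fin n → Bool) (t : ℕ) :
    binMod m f t = binVal f t % m := by
  induction t with
  | zero => simp [binMod, binVal]
  | succ t ih => simp [binMod, binVal, ih, Nat.add_mod, Nat.mul_mod]

theorem binVal_lt {n : ℕ} (f : Fin n → Bool) (t : ℕ) : binVal f t < 2 ^ t := by
  induction t with
  | zero => simp [binVal]
  | succ t ih =>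
    rw [binVal, pow_succ]
    split_ifs with h
    · have := Bool.toNat_le (f ⟨t, h⟩); omega
    · omega

theorem binVal_inj {n : ℕ} {f g : Fin n → Bool} {t : ℕ} (h : binVal f t = binVal g t) :
    ∀ i : Fin n, (i : ℕ) < t → f i = g i := by
  induction t with
  | zero => simp
  | succ t ih =>
    intro i hi
    rw [binVal, binVal] at h
    by_cases ht : t < n
    · rw [dif_pos ht, dif_pos ht] at h
      have h1 := Bool.toNat_le (f ⟨t, ht⟩)
      have h2 := Bool.toNat_le (g ⟨t, ht⟩)
      rcases Nat.lt_succ_iff_lt_or_eq.1 hi with h3 | h3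
      · exact ih (by omega) i h3
      · have : (f ⟨t, ht⟩).toNat = (g ⟨t, ht⟩).toNat := by omega
        rw [show i = ⟨t, ht⟩ from Fin.ext h3]
        revert this
        cases f ⟨t, ht⟩ <;> cases g ⟨t, ht⟩ <;> simp
    · exact ih (by rw [dif_neg ht, dif_neg ht] at h; omega) i (by omega)

theorem binVal_bijective (n : ℕ) :
    Function.Bijective fun f : Fin n → Bool => (⟨binVal f n, binVal_lt f n⟩ : Fin (2 ^ n)) := by
  rw [Fintype.bijective_iff_injective_and_card]
  refine ⟨fun f g h => funext fun i => binVal_inj (Fin.mk.inj h) i i.2, by simp⟩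

/-- The bits give each number below `2 ^ n` exactly once, and a residue class modulo `m` contains `2
^ n / m` of these numbers, rounded down, or one more. -/
theorem abs_unifProb_pick_sub_le {n m : ℕ} (hm : 0 < m) (j : Fin m) :
    |(unifProb fun f : Fin n → Bool => pick hm f = j) - 1 / m| ≤ 1 / 2 ^ n := by
  classical
  have hm' : (0 : ℝ) < m := by exact_mod_cast hm
  have h1 : (unifProb fun f : Fin n → Bool => pick hm f = j) =
      unifProb fun x : Fin (2 ^ n) => (x : ℕ) ≡ j [MOD m] := by
    rw [← unifProb_bijective (binVal_bijective n)]
    congr! 2 with f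
    rw [Fin.ext_iff, Nat.ModEq, Nat.mod_eq_of_lt j.2, ← binMod_eq]
    rfl
  have h2 : (univ.filter fun x : Fin (2 ^ n) => (x : ℕ) ≡ j [MOD m]).card =
      (2 ^ n) / m + if (j : ℕ) % m < (2 ^ n) % m then 1 else 0 := by
    rw [← Nat.count_modEq_card _ hm, Nat.count_eq_card_filter_range]
    rw [← card_map Fin.valEmbedding]
    congr 1
    ext x
    simp only [mem_map, mem_filter, mem_univ, true_and, Fin.valEmbedding_apply, mem_range]
    exact ⟨fun ⟨a, h, e⟩ => e ▸ ⟨a.2, h⟩, fun ⟨h, h'⟩ => ⟨⟨x, h⟩, h', rfl⟩⟩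
  have h3 := Nat.div_add_mod (2 ^ n) m
  have h4 := Nat.mod_lt (2 ^ n) hm
  rw [h1, unifProb]
  have h5 : ((univ.filter fun x : Fin (2 ^ n) => (x : ℕ) ≡ j [MOD m]).card : ℝ) =
      ((2 ^ n / m : ℕ) : ℝ) + if (j : ℕ) % m < (2 ^ n) % m then 1 else 0 := by
    exact_mod_cast h2
  have h6 : (m : ℝ) * ((2 ^ n / m : ℕ) : ℝ) + ((2 ^ n % m : ℕ) : ℝ) = 2 ^ n := by
    exact_mod_cast h3
  have h7 : ((2 ^ n % m : ℕ) : ℝ) ≤ m := by exact_mod_cast h4.le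
  have h8 : (0 : ℝ) ≤ ((2 ^ n % m : ℕ) : ℝ) := Nat.cast_nonneg _
  have hc : (Fintype.card (Fin (2 ^ n)) : ℝ) = 2 ^ n := by simp
  have hp : (0 : ℝ) < 2 ^ n := by positivity
  have h9 : |((univ.filter fun x : Fin (2 ^ n) => (x : ℕ) ≡ j [MOD m]).card : ℝ) - 2 ^ n / m| ≤ 1 := by
    rw [h5, ← h6, add_div, mul_div_cancel_left₀ _ hm'.ne', abs_le]
    have : ((2 ^ n % m : ℕ) : ℝ) / m ≤ 1 := (div_le_one hm').2 h7
    have : 0 ≤ ((2 ^ n % m : ℕ) : ℝ) / m := by positivity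
    split_ifs <;> constructor <;> linarith
  rw [hc]
  calc _ = |((univ.filter fun x : Fin (2 ^ n) => (x : ℕ) ≡ j [MOD m]).card : ℝ) - 2 ^ n / m| / 2 ^ n := by
        rw [← abs_of_pos hp, ← abs_div, abs_of_pos hp, sub_div, div_right_comm, div_self hp.ne']
        congr!
    _ ≤ _ := by gcongr

/-! ## The vector of a constraint -/

section
variable {n K : ℕ} (C : KTuple n K)

theorem coe_unitSign (u : ℤˣ) : ((unitSign u : SignType) : ℝ) = ((u : ℤ) : ℝ) := by
  rcases Int.units_eq_one_or u with rfl | rfl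
  · simp [unitSign]
  · simp [unitSign]

theorem KTuple.vecUpto_of_ne {a : Fin n} (h : ∀ i, C.1 i ≠ a) (k : ℕ) : C.vecUpto a k = 0 := by
  induction k with
  | zero => rfl
  | succ k ih =>
    rw [vecUpto]
    split_ifs with h1 h2
    · exact absurd h2 (h _)
    · exact ih
    · exact ih

theorem KTuple.vecUpto_apply (i : Fin K) (k : ℕ) (hk : (i : ℕ) < k) :
    C.vecUpto (C.1 i) k = unitSign (C.normSign i) := by
  induction k with
  | zero => omega
  | succ k ih =>
    rw [vecUpto]
    split_ifs with h1 h2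
    · rw [C.1.injective h2]
    · refine ih (lt_of_le_of_ne (by omega) fun h3 => h2 ?_)
      congr 1
      exact Fin.ext h3.symm
    · exact ih (by omega)

theorem KTuple.vec_of_ne {a : Fin n} (h : ∀ i, C.1 i ≠ a) : C.vec a = 0 := C.vecUpto_of_ne h K

theorem KTuple.vec_apply (i : Fin K) : C.vec (C.1 i) = unitSign (C.normSign i) :=
  C.vecUpto_apply i K i.2

/-- The literals use different variables, so summing over the support of the vector is summing over
the literals. -/
theorem KTuple.sum_vec (F : Fin n → SignType → ℝ) (hF : ∀ a, F a 0 = 0) :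
    ∑ a, F a (C.vec a) = ∑ i, F (C.1 i) (unitSign (C.normSign i)) := by
  rw [← sum_subset (subset_univ (univ.map C.1)) fun a _ ha => by
    rw [C.vec_of_ne fun i hi => ha (by simp [← hi]), hF]]
  rw [sum_map]
  exact sum_congr rfl fun i _ => by rw [C.vec_apply]

/-- The sum of the signs of the normalized tuple under the assignment `ψ`. -/
def KTuple.signSum (ψ : Fin n → ℤˣ) : ℤ := ∑ i, ((C.normSign i * ψ (C.1 i) : ℤˣ) : ℤ)

theorem KTuple.sum_vec_mul (ψ : Fin n → ℤˣ) :
    ∑ a, (((ψ a : ℤ) : ℝ)) * (C.vec a : ℝ) = (C.signSum ψ : ℝ) := by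
  rw [C.sum_vec (fun a s => ((ψ a : ℤ) : ℝ) * (s : ℝ)) (by simp), signSum]
  push_cast
  exact sum_congr rfl fun i _ => by rw [coe_unitSign, mul_comm]

theorem KTuple.sum_vec_sq : ∑ a, (C.vec a : ℝ) * (C.vec a : ℝ) = K := by
  rw [C.sum_vec (fun a s => (s : ℝ) * (s : ℝ)) (by simp)]
  rw [sum_congr rfl (g := fun _ => (1 : ℝ)) fun i _ => by
    rw [coe_unitSign]; rcases Int.units_eq_one_or (C.normSign i) with h | h <;> simp [h]]
  simp

/-- Normalization changes only the first sign, which factors out of the product. Hence `ψ` satisfies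
the constraint iff the label equals the parity of the normalized signs. -/
theorem KTuple.xor_eval [NeZero K] (ψ : Fin n → ℤˣ) :
    xor (C.eval ψ) = C.2 0 * ∏ i, (C.normSign i * ψ (C.1 i)) := by
  rw [xor]
  simp only [eval, prod_mul_distrib, ← mul_assoc]
  congr 1
  rw [← mul_prod_erase univ _ (mem_univ 0), ← mul_prod_erase univ C.normSign (mem_univ 0)]
  congr 1
  rw [show C.normSign 0 = 1 by simp [normSign], one_mul]
  refine prod_congr rfl fun i hi => ?_
  rw [normSign, if_neg]
  exact fun h => (mem_erase.1 hi).1 (Fin.ext (by simpa using h))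

end

/-- Here `r` counts the entries equal to `-1`; through it the sum determines the product. -/
theorem exists_sum_prod_units {ι : Type} (s : Finset ι) (z : ι → ℤˣ) :
    ∃ r : ℕ, ∑ i ∈ s, ((z i : ℤˣ) : ℤ) = s.card - 2 * r ∧ ∏ i ∈ s, z i = (-1) ^ r := by
  classical
  induction s using Finset.induction_on with
  | empty => exact ⟨0, by simp⟩
  | insert i s hi ih =>
    obtain ⟨r, h1, h2⟩ := ih
    rw [sum_insert hi, prod_insert hi, h1, h2, card_insert_of_notMem hi]
    rcases Int.units_eq_one_or (z i) with h | h
    · exact ⟨r, by rw [h]; push_cast; ring, by rw [h, one_mul]⟩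
    · exact ⟨r + 1, by rw [h]; push_cast; ring, by rw [h, pow_succ']⟩

/-! ## Parities as halfspaces over tensor powers -/

/-- A product of linear forms is a linear form on the tensor power. -/
theorem exists_linear_tensorPow {l : ℕ} (D : ℕ) (u : ℕ → Fin l → ℝ) :
    ∃ w : Fin (l ^ D) → ℝ, ∀ v : Fin l → SignType,
      ∑ x, w x * (tensorPow v D x : ℝ) = ∏ d ∈ range D, ∑ a, u d a * (v a : ℝ) := by
  induction D with
  | zero => exact ⟨fun _ => 1, fun v => by
    simp only [tensorPow, range_zero, prod_empty, SignType.coe_one, mul_one, sum_const, card_univ]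
    simp⟩
  | succ D ih =>
    obtain ⟨w, hw⟩ := ih
    refine ⟨fun x => w (Fin.divNat (m := l ^ D) (n := l) x) *
      u D (Fin.modNat (m := l ^ D) (n := l) x), fun v => ?_⟩
    rw [prod_range_succ, ← hw v, sum_mul_sum, ← Fintype.sum_prod_type',
      ← finProdFinEquiv.symm.sum_comp]
    refine sum_congr rfl fun x _ => ?_
    change w (Fin.divNat (m := l ^ D) (n := l) x) * u D (Fin.modNat (m := l ^ D) (n := l) x) *
      ((tensorPow v D (Fin.divNat (m := l ^ D) (n := l) x) *
        v (Fin.modNat (m := l ^ D) (n := l) x) : SignType) : ℝ) =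
      w (Fin.divNat (m := l ^ D) (n := l) x) *
        (tensorPow v D (Fin.divNat (m := l ^ D) (n := l) x) : ℝ) *
      (u D (Fin.modNat (m := l ^ D) (n := l) x) * (v (Fin.modNat (m := l ^ D) (n := l) x) : ℝ))
    rw [SignType.coe_mul]
    ring

/-- The factors are odd numbers that decrease in steps of two from `2 * A - 1`: the first `A` are
positive, the other `B` negative. -/
theorem neg_one_pow_mul_prod_pos (A B : ℕ) :
    0 < (-1 : ℝ) ^ B * ∏ d ∈ range (A + B), (2 * ((A : ℝ) - d) - 1) := by
  rw [prod_range_add]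
  have h1 : 0 < ∏ d ∈ range A, (2 * ((A : ℝ) - d) - 1) := by
    refine prod_pos fun d hd => ?_
    have : (d : ℝ) + 1 ≤ A := by exact_mod_cast mem_range.1 hd
    linarith
  have h2 : ∏ x ∈ range B, (2 * ((A : ℝ) - (A + x : ℕ)) - 1) =
      (-1) ^ B * ∏ x ∈ range B, (2 * (x : ℝ) + 1) := by
    have h : ∀ x : ℕ, 2 * ((A : ℝ) - (A + x : ℕ)) - 1 = -1 * (2 * (x : ℝ) + 1) := fun x => by
      push_cast; ring
    simp_rw [h, prod_mul_distrib, prod_const, card_range]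
  have h3 : 0 < ∏ x ∈ range B, (2 * (x : ℝ) + 1) := prod_pos fun x _ => by positivity
  rw [h2, mul_left_comm, ← mul_assoc ((-1 : ℝ) ^ B), ← mul_pow]
  norm_num
  positivity

/-- Parities of balanced sign vectors are halfspaces over the tensor power. -/
theorem exists_halfspace_eq_prod {n κ γ : ℕ} (ψ : Fin n → ℤˣ) :
    ∃ w : Fin ((n + 1) ^ (4 * γ)) → ℝ, ∀ C : KTuple n (4 * κ), |C.signSum ψ| ≤ 4 * γ →
      halfspace w (tensorPow (Fin.cons 1 C.vec) (4 * γ)) =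
        ∏ i, (C.normSign i * ψ (C.1 i)) := by
  -- At `(1, v)` the form number `d` has the value `s + 4γ - 1 - 2d` with `s = ⟨ψ, v⟩`, so the roots
  -- are the odd integers between `-4γ` and `4γ`.
  obtain ⟨w, hw⟩ := exists_linear_tensorPow (4 * γ) fun d =>
    (Fin.cons (4 * γ - 1 - 2 * d : ℝ) fun a => ((ψ a : ℤ) : ℝ) : Fin (n + 1) → ℝ)
  refine ⟨w, fun C hC => ?_⟩
  obtain ⟨r, h1, h2⟩ := exists_sum_prod_units univ fun i => C.normSign i * ψ (C.1 i)
  rw [h2, halfspace, hw]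
  change C.signSum ψ = _ at h1
  rw [card_univ, Fintype.card_fin] at h1
  -- `A = (s + 4γ) / 2` is the number of positive factors; `|s| ≤ 4γ` puts it between `0` and `4γ`.
  obtain ⟨A, hA⟩ : ∃ A : ℕ, (A : ℤ) = 2 * κ - r + 2 * γ :=
    ⟨(2 * κ - r + 2 * γ : ℤ).toNat, by
      rw [abs_le, h1] at hC; push_cast at hC; rw [Int.toNat_of_nonneg]; omega⟩
  obtain ⟨B, hB⟩ : ∃ B : ℕ, A + B = 4 * γ :=
    ⟨4 * γ - A, by rw [abs_le, h1] at hC; push_cast at hC; omega⟩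
  have hAr : (A : ℝ) = 2 * κ - r + 2 * γ := by exact_mod_cast hA
  have h1r : (C.signSum ψ : ℝ) = 4 * κ - 2 * r := by rw [h1]; push_cast; ring
  have hp : ∏ d ∈ range (4 * γ), ∑ a, (Fin.cons (4 * γ - 1 - 2 * d : ℝ)
      (fun a => ((ψ a : ℤ) : ℝ)) : Fin (n + 1) → ℝ) a *
        ((Fin.cons 1 C.vec : Fin (n + 1) → SignType) a : ℝ) =
      ∏ d ∈ range (A + B), (2 * ((A : ℝ) - d) - 1) := by
    rw [hB]
    refine prod_congr rfl fun d _ => ?_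
    rw [Fin.sum_univ_succ]
    simp only [Fin.cons_zero, Fin.cons_succ]
    rw [C.sum_vec_mul, h1r, hAr, SignType.coe_one]
    ring
  rw [hp]
  have hpos := neg_one_pow_mul_prod_pos A B
  -- Degree and arity are both multiples of four, so `B = r + 2 (γ - κ)` has the parity of `r` and
  -- no correcting sign is needed.
  have hBr : ∃ c : ℤ, (B : ℤ) = r + 2 * c := ⟨γ - κ, by omega⟩
  obtain ⟨c, hc⟩ := hBr
  rcases Nat.even_or_odd r with hr | hr
  · have hB' : Even B := by
      obtain ⟨r', rfl⟩ := hr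
      exact (Int.even_coe_nat B).1 ⟨r' + c, by rw [hc]; push_cast; ring⟩
    rw [hB'.neg_one_pow, one_mul] at hpos
    rw [if_pos hpos.le, hr.neg_one_pow]
  · have hB' : Odd B := by
      obtain ⟨r', rfl⟩ := hr
      exact (Int.odd_coe_nat B).1 ⟨r' + c, by rw [hc]; push_cast; ring⟩
    rw [hB'.neg_one_pow] at hpos
    rw [if_neg (by linarith), hr.neg_one_pow]

/-! ## Balanced formulas -/

section
variable {n K m : ℕ} (J : KFormula n K m)

theorem sum_signs {ι : Type} (s : Finset ι) (f : ι → SignType) [DecidablePred fun j => f j = 1]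
    [DecidablePred fun j => f j = -1] :
    ∑ j ∈ s, (f j : ℝ) = ((s.filter fun j => f j = 1).card : ℝ) -
      (s.filter fun j => f j = -1).card := by
  rw [← sum_boole, ← sum_boole, ← sum_sub_distrib]
  refine sum_congr rfl fun j _ => ?_
  rcases SignType.trichotomy (f j) with h | h | h <;> simp [h]

theorem sum_vec_mul_vec (a b : Fin n) :
    ∑ j, ((J j).vec a : ℝ) * ((J j).vec b : ℝ) = (pairCount J a b 1 : ℝ) - pairCount J a b (-1) := by
  classical
  rw [pairCount, pairCount, ← sum_signs]
  exact sum_congr rfl fun j _ => (SignType.coe_mul _ _).symm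

variable {J}

theorem balanced_iff {t : ℕ} : Balanced t J ↔ ∀ a b : Fin n, a ≠ b →
    |∑ j, ((J j).vec a : ℝ) * ((J j).vec b : ℝ)| ≤ t := by
  simp only [Balanced, sum_vec_mul_vec, not_exists, not_and, abs_le, not_or, not_lt]
  refine forall_congr' fun a => forall_congr' fun b => forall_congr' fun _ => ?_
  constructor
  · rintro ⟨h1, h2⟩
    have h1' : (pairCount J a b 1 : ℝ) ≤ pairCount J a b (-1) + t := by exact_mod_cast h1
    have h2' : (pairCount J a b (-1) : ℝ) ≤ pairCount J a b 1 + t := by exact_mod_cast h2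
    constructor <;> linarith
  · rintro ⟨h1, h2⟩
    constructor
    · have : (pairCount J a b 1 : ℝ) ≤ pairCount J a b (-1) + t := by linarith
      exact_mod_cast this
    · have : (pairCount J a b (-1) : ℝ) ≤ pairCount J a b 1 + t := by linarith
      exact_mod_cast this

/-- The sum of squares is a quadratic form in the signs `ψ`. Its diagonal gives `K` per constraint,
and balance bounds each off-diagonal coefficient by `t`, uniformly in `ψ`. -/
theorem Balanced.sum_sq_le {t : ℕ} (h : Balanced t J) (ψ : Fin n → ℤˣ) :
    ∑ j, ((J j).signSum ψ : ℝ) ^ 2 ≤ K * m + n ^ 2 * t := by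
  rw [balanced_iff] at h
  have hψ : ∀ a, |((ψ a : ℤ) : ℝ)| = 1 := fun a => by
    rcases Int.units_eq_one_or (ψ a) with h | h <;> simp [h]
  calc _ = ∑ a, ∑ b, ((ψ a : ℤ) : ℝ) * ((ψ b : ℤ) : ℝ) *
        ∑ j, ((J j).vec a : ℝ) * ((J j).vec b : ℝ) := by
        simp_rw [← KTuple.sum_vec_mul, sq, sum_mul_sum, mul_sum]
        rw [sum_comm]
        refine sum_congr rfl fun a _ => ?_
        rw [sum_comm]
        exact sum_congr rfl fun b _ => sum_congr rfl fun j _ => by ring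
    _ ≤ ∑ a, ∑ b, ((if a = b then ∑ j, ((J j).vec a : ℝ) * ((J j).vec a : ℝ) else 0) + t) := by
        refine sum_le_sum fun a _ => sum_le_sum fun b _ => ?_
        by_cases hab : a = b
        · subst hab
          have : ((ψ a : ℤ) : ℝ) * ((ψ a : ℤ) : ℝ) = 1 := by rw [← abs_mul_abs_self, hψ]; simp
          rw [if_pos rfl, this, one_mul]
          simp
        · rw [if_neg hab, zero_add]
          refine (le_abs_self _).trans ?_
          rw [abs_mul, abs_mul, hψ, hψ, one_mul, one_mul]
          exact h a b hab
    _ = (∑ j, ∑ a, ((J j).vec a : ℝ) * ((J j).vec a : ℝ)) + n ^ 2 * t := by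
        simp only [sum_add_distrib, sum_ite_eq, mem_univ, if_true, sum_const, card_univ,
          Fintype.card_fin, nsmul_eq_mul]
        rw [sum_comm]
        ring
    _ = _ := by
        simp_rw [KTuple.sum_vec_sq]
        simp [mul_comm]

end

/-! ## Random formulas -/

/-- All correlations over random formulas are shown to vanish through a sign-reversing symmetry of
this kind. -/
theorem sum_eq_zero_of_equiv {α : Type} [Fintype α] (e : α ≃ α) {F : α → ℝ}
    (h : ∀ a, F (e a) = -F a) : ∑ a, F a = 0 := by
  have := e.sum_comp F
  simp only [h, sum_neg_distrib] at this
  linarith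

section
variable {n K m : ℕ}

/-- Apply a permutation of the tuples to the `j`-th constraint. -/
def updateEquiv (e : KTuple n K ≃ KTuple n K) (j : Fin m) : KFormula n K m ≃ KFormula n K m :=
  Equiv.piCongrRight fun i => if i = j then e else Equiv.refl _

theorem updateEquiv_same (e : KTuple n K ≃ KTuple n K) (j : Fin m) (J : KFormula n K m) :
    updateEquiv e j J j = e (J j) := by simp [updateEquiv]

theorem updateEquiv_ne (e : KTuple n K ≃ KTuple n K) {i j : Fin m} (h : i ≠ j)
    (J : KFormula n K m) : updateEquiv e j J i = J i := by simp [updateEquiv, h]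

/-! ### Sign-flipping symmetries of a random tuple -/

section flip
variable [NeZero K]

/-- The variable whose sign is flipped by `flipPair`: one of `a` and `b` that is not the variable of
the first literal. -/
def KTuple.target (a b : Fin n) (C : KTuple n K) : Fin n := if C.1 0 = a then b else a

/-- Flip the sign of a non-leading literal on `a` or `b`. -/
def KTuple.flipPair (a b : Fin n) (C : KTuple n K) : KTuple n K :=
  (C.1, fun i => if C.1 i = C.target a b then -C.2 i else C.2 i)

theorem KTuple.flipPair_involutive (a b : Fin n) :
    Function.Involutive (KTuple.flipPair (K := K) a b) := by
  intro C
  refine Prod.ext rfl (funext fun i => ?_)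
  change (if C.1 i = C.target a b then -(if C.1 i = C.target a b then -C.2 i else C.2 i)
    else (if C.1 i = C.target a b then -C.2 i else C.2 i)) = C.2 i
  split_ifs <;> simp

/-- Normalization would hide a flip of the leading literal; the target avoids its variable, so the
flip is visible in the vector. -/
theorem KTuple.vec_flipPair {a b : Fin n} (hab : a ≠ b) (C : KTuple n K) (v : Fin n) :
    (C.flipPair a b).vec v = if v = C.target a b then -C.vec v else C.vec v := by
  by_cases h : ∃ i, C.1 i = v
  · obtain ⟨i, rfl⟩ := h
    have h0 : C.1 i = C.target a b → (i : ℕ) ≠ 0 := by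
      intro h1 h2
      have hi : i = 0 := Fin.ext (by simpa using h2)
      subst hi
      rw [target] at h1
      split_ifs at h1 with h3
      · exact hab (h3.symm.trans h1)
      · exact h3 h1
    rw [show C.1 i = (C.flipPair a b).1 i from rfl, KTuple.vec_apply,
      show (C.flipPair a b).1 i = C.1 i from rfl, KTuple.vec_apply]
    simp only [normSign, flipPair]
    by_cases h1 : C.1 i = C.target a b
    · simp only [if_pos h1, if_neg (h0 h1)]
      rcases Int.units_eq_one_or (C.2 i) with h2 | h2 <;> rw [h2] <;> decide
    · simp only [if_neg h1]
  · push Not at h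
    rw [C.vec_of_ne h, (C.flipPair a b).vec_of_ne h]
    simp

theorem KTuple.vec_mul_vec_flipPair {a b : Fin n} (hab : a ≠ b) (C : KTuple n K) :
    (((C.flipPair a b).vec a : ℝ)) * ((C.flipPair a b).vec b : ℝ) =
      -((C.vec a : ℝ) * (C.vec b : ℝ)) := by
  have hneg : ∀ s : SignType, ((-s : SignType) : ℝ) = -(s : ℝ) := fun s => by cases s <;> simp
  rw [vec_flipPair hab, vec_flipPair hab, target]
  by_cases h : C.1 0 = a
  · rw [if_pos h, if_neg hab, if_pos rfl, hneg]; ring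
  · rw [if_neg h, if_pos rfl, if_neg hab.symm, hneg]; ring

/-- Flip the sign of the first literal. -/
def KTuple.flipFirst (C : KTuple n K) : KTuple n K := (C.1, Function.update C.2 0 (-C.2 0))

theorem KTuple.flipFirst_involutive : Function.Involutive (KTuple.flipFirst (n := n) (K := K)) := by
  intro C
  simp [flipFirst]

/-- The first sign enters only the label. The flip therefore negates the label and preserves the
instance. -/
theorem KTuple.vec_flipFirst (C : KTuple n K) : C.flipFirst.vec = C.vec := by
  have h : C.flipFirst.normSign = C.normSign := by
    funext i
    simp only [normSign, flipFirst]
    split_ifs with h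
    · rfl
    · rw [Function.update_of_ne fun hi => h (by simp [hi])]
  funext v
  by_cases hv : ∃ i, C.1 i = v
  · obtain ⟨i, rfl⟩ := hv
    rw [show C.1 i = C.flipFirst.1 i from rfl, KTuple.vec_apply, h,
      show C.flipFirst.1 i = C.1 i from rfl, KTuple.vec_apply]
  · push Not at hv
    rw [C.vec_of_ne hv, C.flipFirst.vec_of_ne hv]

end flip

theorem abs_coe_signType_le (s : SignType) : |(s : ℝ)| ≤ 1 := by cases s <;> simp

/-- A random formula is balanced with high probability. -/
theorem unifProb_not_balanced_le [NeZero K] {t : ℕ} (ht : 0 < t) :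
    unifProb (fun J : KFormula n K m => ¬ Balanced t J) ≤ n ^ 2 * (m / t ^ 2) := by
  have htr : (0 : ℝ) < t := by exact_mod_cast ht
  have key : ∀ a b : Fin n, unifProb (fun J : KFormula n K m =>
      a ≠ b ∧ (t : ℝ) ≤ |∑ j, ((J j).vec a : ℝ) * ((J j).vec b : ℝ)|) ≤ m / t ^ 2 := by
    intro a b
    by_cases hab : a = b
    · refine (unifProb_mono (F := fun _ => False) fun J h => h.1 hab).trans ?_
      rw [show unifProb (fun _ : KFormula n K m => False) = 0 by simp [unifProb]]
      positivity
    refine (unifProb_mono fun J h => h.2).trans ?_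
    have := unifProb_chebyshev (α := KFormula n K m) univ
      (fun j J => ((J j).vec a : ℝ) * ((J j).vec b : ℝ))
      (fun j J => by
        rw [abs_mul]
        exact mul_le_one₀ (abs_coe_signType_le _) (abs_nonneg _) (abs_coe_signType_le _))
      (fun j _ k _ hjk => sum_eq_zero_of_equiv
        (updateEquiv (KTuple.flipPair_involutive a b).toPerm j) fun J => by
          rw [updateEquiv_same, updateEquiv_ne _ hjk.symm, Function.Involutive.coe_toPerm,
            KTuple.vec_mul_vec_flipPair hab]
          ring) htr
    simpa using this
  calc _ ≤ unifProb (fun J : KFormula n K m => ∃ x : Fin n × Fin n,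
        x.1 ≠ x.2 ∧ (t : ℝ) ≤ |∑ j, ((J j).vec x.1 : ℝ) * ((J j).vec x.2 : ℝ)|) := by
        refine unifProb_mono fun J h => ?_
        rw [balanced_iff] at h
        push Not at h
        obtain ⟨a, b, hab, h⟩ := h
        exact ⟨(a, b), hab, h.le⟩
    _ ≤ ∑ x : Fin n × Fin n, (m / t ^ 2 : ℝ) :=
        (unifProb_exists_le _).trans (sum_le_sum fun x _ => key x.1 x.2)
    _ = _ := by
        rw [sum_const, card_univ, Fintype.card_prod, Fintype.card_fin, nsmul_eq_mul]
        push_cast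
        ring

/-- On a random formula, the hypothesis learnt from few constraints is correct on about one half of
the constraints. -/
theorem unifProb_numCorrect_le {b D : ℕ} [NeZero K] (H : LearningRule b) (hm : 0 < m)
    (u : Fin (numEx b D n) → Fin (n + 1) → Bool) {θ : ℕ} (hθ : 0 < θ)
    (hq : 2 * numEx b D n ≤ θ) :
    unifProb (fun J : KFormula n K m => m + θ ≤ 2 * numCorrect J (trialHyp H D hm J u)) ≤
      4 * m / θ ^ 2 := by
  classical
  -- The sampled indices depend on the coins `u` alone, so `Q` stays fixed while `J` varies.
  let Q : Finset (Fin m) := univ.image fun s => pick hm fun t : Fin n => u s t.castSucc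
  have hQ : Q.card ≤ numEx b D n := card_image_le.trans (by simp)
  let Y : Fin m → KFormula n K m → ℝ := fun j J =>
    ((trialHyp H D hm J u ((J j).toExample D).1 * ((J j).toExample D).2 : ℤˣ) : ℤ)
  have habs : ∀ v : ℤˣ, |((v : ℤ) : ℝ)| = 1 := fun v => by
    rcases Int.units_eq_one_or v with h | h <;> simp [h]
  have hθr : (0 : ℝ) < θ := by exact_mod_cast hθ
  let e : KTuple n K ≃ KTuple n K := KTuple.flipFirst_involutive.toPerm
  have hex : ∀ C : KTuple n K, ((e C).toExample D).1 = (C.toExample D).1 := fun C => by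
    change tensorPow (Fin.cons 1 C.flipFirst.vec) D = tensorPow (Fin.cons 1 C.vec) D
    rw [C.vec_flipFirst]
  have hey : ∀ C : KTuple n K, ((e C).toExample D).2 = -(C.toExample D).2 := fun C => by
    change Function.update C.2 0 (-C.2 0) 0 = -C.2 0
    simp
  -- The learner never sees constraint `j`, so flipping its first literal negates `Y j` and
  -- preserves all other `Y k`.
  have hhyp : ∀ j ∉ Q, ∀ J : KFormula n K m,
      trialHyp H D hm (updateEquiv e j J) u = trialHyp H D hm J u := fun j hj J => by
    unfold trialHyp
    congr 1
    funext s
    rw [updateEquiv_ne]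
    rintro rfl
    exact hj (mem_image_of_mem _ (mem_univ s))
  have hYabs : ∀ j J, |Y j J| ≤ 1 := fun j J => (habs _).le
  -- The threshold is `θ / 2` because the sampled constraints, at most `θ / 2` of them, may all be
  -- predicted correctly.
  have hcheb := unifProb_chebyshev (univ \ Q) Y hYabs
    (fun j hj k _ hjk => sum_eq_zero_of_equiv (updateEquiv e j) fun J => by
      simp only [Y]
      rw [hhyp j (by simpa using hj), updateEquiv_same, updateEquiv_ne _ hjk.symm, hex, hey]
      push_cast
      ring) (half_pos hθr)
  refine (unifProb_mono fun J hJ => ?_).trans (hcheb.trans ?_)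
  · have h1 : ∑ j, Y j J = 2 * (numCorrect J (trialHyp H D hm J u) : ℝ) - m := by
      rw [numCorrect, ← sum_boole, mul_sum,
        show (m : ℝ) = ∑ _j : Fin m, (1 : ℝ) by simp, ← sum_sub_distrib]
      refine sum_congr rfl fun j _ => ?_
      simp only [Y]
      rcases Int.units_eq_one_or (trialHyp H D hm J u ((J j).toExample D).1) with h | h <;>
      rcases Int.units_eq_one_or ((J j).toExample D).2 with h' | h' <;> rw [h, h']
      · norm_num
      · rw [if_neg (by decide)]; norm_num
      · rw [if_neg (by decide)]; norm_num
      · norm_num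
    have h2 : ∑ j ∈ Q, Y j J ≤ numEx b D n := by
      calc _ ≤ ∑ _j ∈ Q, (1 : ℝ) := sum_le_sum fun j _ => (le_abs_self _).trans (hYabs j J)
        _ ≤ _ := by rw [sum_const, nsmul_eq_mul, mul_one]; exact_mod_cast hQ
    have h3 := sum_sdiff (f := fun j => Y j J) (subset_univ Q)
    have h4 : (m : ℝ) + θ ≤ 2 * (numCorrect J (trialHyp H D hm J u) : ℝ) := by exact_mod_cast hJ
    have h5 : 2 * (numEx b D n : ℝ) ≤ θ := by exact_mod_cast hq
    refine le_trans ?_ (le_abs_self _)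
    linarith
  · have h6 : ((univ \ Q).card : ℝ) ≤ m := by
      exact_mod_cast (card_le_univ _).trans (by simp)
    calc _ ≤ (m : ℝ) / (θ / 2 : ℝ) ^ 2 := by gcongr
      _ = _ := by field_simp; norm_num

end

/-! ### Images of the uniform distribution -/

section
variable {α β : Type} [Fintype α]

theorem sum_ite_unifProb [Fintype β] (φ : α → β) (P : β → Prop) [DecidablePred P] :
    ∑ x, (if P x then unifProb fun a => φ a = x else 0) = unifProb fun a => P (φ a) := by
  classical
  simp_rw [unifProb_eq_sum]
  rw [← sum_filter, ← sum_div, sum_comm]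
  congr 1
  refine sum_congr rfl fun a _ => ?_
  rw [sum_ite_eq]
  simp

theorem unifProb_of_forall [Nonempty α] {E : α → Prop} (h : ∀ a, E a) : unifProb E = 1 := by
  classical
  have hpos : (0 : ℝ) < Fintype.card α := by exact_mod_cast Fintype.card_pos
  rw [unifProb_def, filter_true_of_mem fun a _ => h a, card_univ, div_self hpos.ne']

theorem unifProb_le_one [Nonempty α] (E : α → Prop) : unifProb E ≤ 1 :=
  (unifProb_mono fun _ _ => trivial).trans (unifProb_of_forall (E := fun _ : α => True)
    fun _ => trivial).le

theorem unifProb_image_mem_stdSimplex [Nonempty α] [Fintype β] (φ : α → β) :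
    (fun x => unifProb fun a => φ a = x) ∈ stdSimplex ℝ β := by
  refine ⟨fun x => unifProb_nonneg _, ?_⟩
  have := sum_ite_unifProb φ fun _ => True
  simpa [unifProb_of_forall (E := fun _ : α => True)] using this

end

theorem abs_unifProb_pick_event_sub_le {n m : ℕ} (hm : 0 < m) (E : Fin m → Prop)
    [DecidablePred E] :
    |(unifProb fun f : Fin n → Bool => E (pick hm f)) - (univ.filter E).card / m| ≤
      m / 2 ^ n := by
  have h1 : ((univ.filter E).card : ℝ) / m = ∑ j, if E j then (1 / m : ℝ) else 0 := by
    rw [← sum_filter, sum_const, nsmul_eq_mul]; ring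
  rw [← sum_ite_unifProb, h1, ← sum_sub_distrib]
  calc _ ≤ ∑ j : Fin m, (1 / 2 ^ n : ℝ) := by
        refine (abs_sum_le_sum_abs _ _).trans (sum_le_sum fun j _ => ?_)
        split_ifs
        · exact abs_unifProb_pick_sub_le hm j
        · simp
    _ = _ := by rw [sum_const, card_univ, Fintype.card_fin, nsmul_eq_mul]; ring

/-! ## Satisfiable formulas -/

section
variable {n K m b D : ℕ} [NeZero K]

/-- The distribution of the example of the constraint that is picked by random coins. -/
noncomputable def exampleDist (D : ℕ) (hm : 0 < m) (J : KFormula n K m) :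
    Example ((n + 1) ^ D) → ℝ :=
  fun x => unifProb fun f : Fin n → Bool => (J (pick hm f)).toExample D = x

theorem err_exampleDist (hm : 0 < m) (J : KFormula n K m) (h : Inst ((n + 1) ^ D) → ℤˣ) :
    err (exampleDist D hm J) h = unifProb fun f : Fin n → Bool =>
      h ((J (pick hm f)).toExample D).1 ≠ ((J (pick hm f)).toExample D).2 :=
  sum_ite_unifProb (fun f : Fin n → Bool => (J (pick hm f)).toExample D) fun e => h e.1 ≠ e.2

/-- A record of `n + 1` coins splits into `n` bits that pick a constraint and one coin for the
learner. The examples of a trial are thus independent with law exactly `exampleDist`; the bias of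
`pick` matters only when errors are compared with fractions of constraints. -/
theorem successProb_exampleDist (H : LearningRule b) (hm : 0 < m) (J : KFormula n K m) (ε : ℝ) :
    successProb H (exampleDist D hm J) ε =
      unifProb fun u : Fin (numEx b D n) → Fin (n + 1) → Bool =>
        err (exampleDist D hm J) (trialHyp H D hm J u) ≤ ε := by
  classical
  let Φ : (Fin (numEx b D n) → Fin (n + 1) → Bool) →
      (Fin (numEx b D n) → Fin n → Bool) × (Fin (numEx b D n) → Bool) :=
    fun u => (fun s t => u s t.castSucc, fun s => u s (Fin.last n))
  have hΦ : Function.Bijective Φ := by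
    refine Function.bijective_iff_has_inverse.2
      ⟨fun x s => Fin.snoc (α := fun _ => Bool) (x.1 s) (x.2 s), fun u => ?_, fun x => ?_⟩
    · funext s
      exact Fin.snoc_init_self (α := fun _ => Bool) (u s)
    · refine Prod.ext (funext fun s => funext fun t => ?_) (funext fun s => ?_) <;> simp [Φ]
  have h := sum_prod_unifProb_mul (fun f : Fin n → Bool => (J (pick hm f)).toExample D)
    (numEx b D n) fun S => unifProb fun r : Fin (numEx b D n) → Bool =>
      err (exampleDist D hm J) (H ((n + 1) ^ D) S r) ≤ ε
  refine h.trans ?_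
  symm
  calc _ = unifProb fun x : (Fin (numEx b D n) → Fin n → Bool) × (Fin (numEx b D n) → Bool) =>
        err (exampleDist D hm J) (H ((n + 1) ^ D)
          ((fun f : Fin n → Bool => (J (pick hm f)).toExample D) ∘ x.1) x.2) ≤ ε :=
        unifProb_bijective hΦ fun x => err (exampleDist D hm J) (H ((n + 1) ^ D)
          ((fun f : Fin n → Bool => (J (pick hm f)).toExample D) ∘ x.1) x.2) ≤ ε
    _ = _ := by
      simp_rw [unifProb_eq_sum]
      rw [Fintype.sum_prod_type, ← sum_div, Fintype.card_prod]
      push_cast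
      rw [div_div, mul_comm]

/-- A hypothesis with small error under the sampling distribution is correct on clearly more than
one half of the constraints. -/
theorem le_numCorrect {κ e : ℕ} (hm : 0 < n ^ κ) (J : KFormula n K (n ^ κ))
    (h : Inst ((n + 1) ^ D) → ℤˣ) {ε : ℝ} (hε : 1 / (n : ℝ) ^ e ≤ ε) (he : e ≤ κ)
    (h2 : 2 * (n : ℝ) ^ κ * n ^ e ≤ 2 ^ n) (herr : err (exampleDist D hm J) h ≤ 1 / 2 - ε) :
    n ^ κ + n ^ (κ - e) ≤ 2 * numCorrect J h := by
  classical
  rcases Nat.eq_zero_or_pos n with rfl | hn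
  · rcases Nat.eq_zero_or_pos κ with rfl | hκ
    · obtain rfl : e = 0 := by omega
      norm_num at h2
    · simp [hκ.ne'] at hm
  have hnr : (0 : ℝ) < n := by exact_mod_cast hn
  have hmr : (0 : ℝ) < (n : ℝ) ^ κ := by positivity
  rw [err_exampleDist] at herr
  have h3 := (abs_le.1 (abs_unifProb_pick_event_sub_le (n := n) hm fun j =>
    h ((J j).toExample D).1 ≠ ((J j).toExample D).2)).1
  have h4 : (univ.filter fun j => h ((J j).toExample D).1 ≠ ((J j).toExample D).2).card +
      numCorrect J h = n ^ κ := by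
    rw [numCorrect, add_comm, card_filter_add_card_filter_not, card_univ, Fintype.card_fin]
  set w := (univ.filter fun j => h ((J j).toExample D).1 ≠ ((J j).toExample D).2).card
  have h5 : (w : ℝ) + numCorrect J h = (n : ℝ) ^ κ := by exact_mod_cast h4
  push_cast at h3
  have h6 : (w : ℝ) / (n : ℝ) ^ κ ≤ 1 / 2 - 1 / (n : ℝ) ^ e + (n : ℝ) ^ κ / 2 ^ n := by linarith
  -- The sampling bias consumes at most half of the advantage `n ^ (-e)`; the other half suffices
  -- because the conclusion concerns twice the number of correct constraints.
  have h7 : (n : ℝ) ^ κ / 2 ^ n ≤ 1 / 2 * (1 / (n : ℝ) ^ e) := by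
    rw [div_le_iff₀ (by positivity), ← div_eq_mul_one_div, div_mul_eq_mul_div, div_mul_eq_mul_div,
      le_div_iff₀ (by positivity)]
    linarith
  rw [div_le_iff₀ hmr] at h6
  have h8 : (n : ℝ) ^ (κ - e) = 1 / (n : ℝ) ^ e * (n : ℝ) ^ κ := by
    rw [eq_comm, one_div_mul_eq_div, div_eq_iff (by positivity), ← pow_add]
    congr 1
    omega
  have h9 : (n : ℝ) ^ κ + (n : ℝ) ^ (κ - e) ≤ 2 * numCorrect J h := by
    rw [h8]
    have := mul_le_mul_of_nonneg_right h7 hmr.le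
    nlinarith
  exact_mod_cast h9

end

/-- The examples of a balanced formula of large value are almost realizable by halfspaces. -/
theorem errHalf_exampleDist_le {n m κ γ : ℕ} [NeZero (4 * κ)] (hm : 0 < m)
    (J : KFormula n (4 * κ) m) (hJ : 1 - 1 / 100 ≤ val J) {t : ℕ} (hbal : Balanced t J)
    (ht : n ^ 2 * t ≤ m) (hγ : 200 * (4 * κ + 1) ≤ 16 * γ ^ 2) (h2 : 200 * (m : ℝ) ≤ 2 ^ n) :
    errHalf (exampleDist (4 * γ) hm J) ≤ 2 / 100 := by
  classical
  have hmr : (0 : ℝ) < m := by exact_mod_cast hm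
  obtain ⟨ψ, hψ⟩ := exists_eq_ciSup_of_finite (f := fun ψ => valAt J ψ)
  rw [val, ← hψ] at hJ
  obtain ⟨w, hw⟩ := exists_halfspace_eq_prod (κ := κ) (γ := γ) ψ
  refine (ciInf_le ⟨0, ?_⟩ w).trans ?_
  · rintro _ ⟨w, rfl⟩
    simp only [err_exampleDist]
    exact unifProb_nonneg _
  rw [err_exampleDist]
  have h3 := (abs_le.1 (abs_unifProb_pick_event_sub_le (n := n) hm fun j =>
    halfspace w ((J j).toExample (4 * γ)).1 ≠ ((J j).toExample (4 * γ)).2)).2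
  set bad := (univ.filter fun j =>
    halfspace w ((J j).toExample (4 * γ)).1 ≠ ((J j).toExample (4 * γ)).2).card with hbad
  -- The error budget is 1/100 for constraints violated by `ψ` (`U`), 1/200 for sign sums outside
  -- the range of the polynomial (`V`), and 1/200 for the bias of `pick`.
  let U := univ.filter fun j => ¬ xor ((J j).eval ψ) = 1
  let V := univ.filter fun j => ¬ |(J j).signSum ψ| ≤ 4 * γ
  have hUV : bad ≤ U.card + V.card := by
    refine (card_le_card fun j hj => ?_).trans (card_union_le U V)
    rw [mem_union]
    by_contra hcon
    simp only [U, V, mem_filter, mem_univ, true_and, not_or, not_not] at hcon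
    refine (mem_filter.1 hj).2 ?_
    change halfspace w (tensorPow (Fin.cons 1 (J j).vec) (4 * γ)) = (J j).2 0
    rw [hw _ hcon.2]
    have h5 := hcon.1
    rw [KTuple.xor_eval] at h5
    rw [← mul_one ((J j).2 0), ← h5, ← mul_assoc, Int.units_mul_self, one_mul]
  have hU : (U.card : ℝ) ≤ m / 100 := by
    have h6 := card_filter_add_card_filter_not (s := (univ : Finset (Fin m)))
      (fun j => xor ((J j).eval ψ) = 1)
    rw [card_univ, Fintype.card_fin] at h6
    have h7 : (((univ.filter fun j => xor ((J j).eval ψ) = 1).card : ℕ) : ℝ) + U.card = m := by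
      exact_mod_cast h6
    have h8 : (1 - 1 / 100 : ℝ) * m ≤ ((univ.filter fun j => xor ((J j).eval ψ) = 1).card : ℕ) :=
      (le_div_iff₀ hmr).1 hJ
    linarith
  have hV : (V.card : ℝ) ≤ m / 200 := by
    have h6 := hbal.sum_sq_le ψ
    -- Markov's inequality for the squared sign sums, each of which exceeds `(4γ)²` on `V`.
    have h7 : (V.card : ℝ) * (16 * γ ^ 2) ≤ ∑ j, ((J j).signSum ψ : ℝ) ^ 2 := by
      rw [← nsmul_eq_mul, ← sum_const]
      refine (sum_le_sum fun j hj => ?_).trans (sum_le_sum_of_subset_of_nonneg (subset_univ V)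
        fun j _ _ => sq_nonneg _)
      have h8 := (mem_filter.1 hj).2
      push Not at h8
      have h9 : (4 * γ : ℝ) ≤ |((J j).signSum ψ : ℝ)| := by exact_mod_cast h8.le
      have h9' := pow_le_pow_left₀ (by positivity) h9 2
      rw [sq_abs] at h9'
      linarith
    have h10 : (n : ℝ) ^ 2 * t ≤ m := by exact_mod_cast ht
    have h11 : (200 : ℝ) * (4 * κ + 1) ≤ 16 * γ ^ 2 := by exact_mod_cast hγ
    push_cast at h6
    have h12 : (V.card : ℝ) * (16 * γ ^ 2) ≤ (4 * κ + 1) * m := by linarith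
    have h13 : (V.card : ℝ) * (200 * (4 * κ + 1)) ≤ (4 * κ + 1) * m :=
      (mul_le_mul_of_nonneg_left h11 (Nat.cast_nonneg _)).trans h12
    have h14 : (0 : ℝ) < 4 * κ + 1 := by positivity
    rw [le_div_iff₀ (by norm_num)]
    refine le_of_mul_le_mul_right ?_ h14
    linarith
  have hb : (bad : ℝ) / m ≤ 3 / 200 := by
    rw [div_le_iff₀ hmr]
    have : (bad : ℝ) ≤ U.card + V.card := by exact_mod_cast hUV
    linarith
  have hs : (m : ℝ) / 2 ^ n ≤ 1 / 200 := by
    rw [div_le_div_iff₀ (by positivity) (by norm_num)]; linarith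
  linarith

open Filter

/-! ## Correctness of the distinguisher -/

section
variable {b n κ γ e n₀ B : ℕ} [NeZero (4 * κ)] {H : LearningRule b}
  {hB : n * numEx b (4 * γ) n * (n + 1) ≤ n ^ B + B}

theorem coinIndex_injective {n q T : ℕ} (hT : n * q * (n + 1) ≤ T) :
    Function.Injective (coinIndex hT) := by
  rintro ⟨ρ, s, t⟩ ⟨ρ', s', t'⟩ h
  have h0 : (ρ * q + s : ℕ) * (n + 1) + t = (ρ' * q + s') * (n + 1) + t' := Fin.mk.inj h
  have key : ∀ {a a' k c c' : ℕ}, c < k → c' < k → a * k + c = a' * k + c' → a = a' ∧ c = c' := by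
    intro a a' k c c' hc hc' h
    have hk : 0 < k := by omega
    have h1 := congrArg (· / k) h
    have h2 := congrArg (· % k) h
    simp only [Nat.mul_add_mod', Nat.mod_eq_of_lt hc, Nat.mod_eq_of_lt hc'] at h2
    simp only [mul_comm _ k, Nat.mul_add_div hk, Nat.div_eq_of_lt hc, Nat.div_eq_of_lt hc',
      add_zero] at h1
    exact ⟨h1, h2⟩
  obtain ⟨h1, h2⟩ := key t.2 t'.2 h0
  obtain ⟨h3, h4⟩ := key s.2 s'.2 h1
  rw [Fin.ext h2, Fin.ext h3, Fin.ext h4]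

/-- Different trials read disjoint blocks of coins and are therefore independent. -/
theorem unifProb_exists_trial {q T : ℕ} (hT : n * q * (n + 1) ≤ T)
    (P : (Fin q → Fin (n + 1) → Bool) → Prop) :
    unifProb (fun r : Fin T → Bool => ∃ ρ, P fun s t => r (coinIndex hT (ρ, s, t))) =
      1 - (1 - unifProb P) ^ n := by
  classical
  have h1 := unifProb_comp_injective (coinIndex_injective hT)
    fun u => ∃ ρ, P fun s t => u (ρ, s, t)
  have h2 : Function.Bijective fun (u : Fin n × Fin q × Fin (n + 1) → Bool) (ρ : Fin n)
      (s : Fin q) (t : Fin (n + 1)) => u (ρ, s, t) :=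
    Function.bijective_iff_has_inverse.2 ⟨fun v x => v x.1 x.2.1 x.2.2, fun _ => rfl,
      fun _ => rfl⟩
  have h3 := unifProb_bijective h2 fun v => ∃ ρ, P (v ρ)
  refine h1.trans (h3.trans ?_)
  rw [← unifProb_not P, ← unifProb_forall, ← unifProb_not]
  congr! 3 with u
  simp

/-- The distinguisher accepts formulas of large value. -/
theorem le_unifProb_accept {δ c : ℝ} (J : KFormula n (4 * κ) (n ^ κ))
    (hJ : 1 - 1 / 100 ≤ val J) (hκ : 2 ≤ κ) (he : e ≤ κ) (hγ : 200 * (4 * κ + 1) ≤ 16 * γ ^ 2)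
    (hn : n₀ ≤ n → 0 < n ∧ 200 * (n : ℝ) ^ κ ≤ 2 ^ n ∧ 2 * (n : ℝ) ^ κ * n ^ e ≤ 2 ^ n ∧
      1 / (n : ℝ) ^ e ≤ 1 / (((n + 1) ^ (4 * γ) : ℕ) : ℝ) ^ c ∧ (1 - δ) ^ n ≤ 1 / 4 ∧
      ∀ D ∈ stdSimplex ℝ (Example ((n + 1) ^ (4 * γ))), errHalf D ≤ 2 / 100 →
        δ ≤ successProb H D (1 / 2 - 1 / (((n + 1) ^ (4 * γ) : ℕ) : ℝ) ^ c)) :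
    3 / 4 ≤ unifProb fun r : Fin (n ^ B + B) → Bool =>
      Accept H (4 * γ) n₀ e J fun x => r (coinIndex hB x) := by
  -- Large value must be recognized for every `n`, while random formulas matter only asymptotically.
  -- So the small `n`, where the learner guarantees nothing, are always accepted.
  by_cases h0 : n < n₀
  · exact le_trans (by norm_num) (unifProb_of_forall fun r => Or.inl h0).ge
  by_cases hbal : Balanced (n ^ (κ - 2)) J
  swap
  · exact le_trans (by norm_num) (unifProb_of_forall fun r => Or.inr (Or.inl hbal)).ge
  obtain ⟨hn0, h200, h2, hε, hδ, hL⟩ := hn (not_lt.1 h0)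
  have hm : 0 < n ^ κ := Nat.pow_pos hn0
  have hs := hL _ (unifProb_image_mem_stdSimplex _) (errHalf_exampleDist_le hm J hJ hbal
    (by rw [← pow_add]; exact (congrArg _ (by omega)).le) hγ (by exact_mod_cast h200))
  change δ ≤ successProb H (exampleDist (4 * γ) hm J) _ at hs
  rw [successProb_exampleDist] at hs
  have hs' := hs.trans (unifProb_mono (F := fun u =>
    n ^ κ + n ^ (κ - e) ≤ 2 * numCorrect J (trialHyp H (4 * γ) hm J u)) fun u hu =>
      le_numCorrect hm J _ hε he h2 hu)
  have hp := unifProb_exists_trial hB fun u =>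
    n ^ κ + n ^ (κ - e) ≤ 2 * numCorrect J (trialHyp H (4 * γ) hm J u)
  refine le_trans ?_ (unifProb_mono fun r hr => Or.inr (Or.inr hr))
  rw [hp]
  have := pow_le_pow_left₀ (sub_nonneg.2 (unifProb_le_one fun u =>
    n ^ κ + n ^ (κ - e) ≤ 2 * numCorrect J (trialHyp H (4 * γ) hm J u)))
    (sub_le_sub_left hs' 1) n
  linarith

/-- The distinguisher rejects most formulas. -/
theorem unifProb_accept_le {D : ℕ} {hB : n * numEx b D n * (n + 1) ≤ n ^ B + B} (h0 : n₀ ≤ n)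
    (hn : 0 < n) (hκ : 7 ≤ κ) (he : 2 * e + 2 ≤ κ) (hq : 2 * numEx b D n ≤ n ^ (κ - e)) :
    unifProb (fun J : KFormula n (4 * κ) (n ^ κ) => 1 / 4 < unifProb
      fun r : Fin (n ^ B + B) → Bool => Accept H D n₀ e J fun x => r (coinIndex hB x)) ≤
      17 / n := by
  have hnr : (0 : ℝ) < n := by exact_mod_cast hn
  have hn1 : (1 : ℝ) ≤ n := by exact_mod_cast hn
  have hm : 0 < n ^ κ := Nat.pow_pos hn
  let P := fun (J : KFormula n (4 * κ) (n ^ κ)) (r : Fin (n ^ B + B) → Bool) =>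
    ∃ ρ : Fin n, n ^ κ + n ^ (κ - e) ≤ 2 * numCorrect J
      (trialHyp H D hm J fun s t => r (coinIndex hB (ρ, s, t)))
  -- One trial succeeds with probability at most `4 n^κ / n^(2(κ-e)) ≤ 4 / n²`, since `2e + 2 ≤ κ`;
  -- the union bound over `n` trials gives `4 / n`.
  have hP : ∀ r, unifProb (fun J => P J r) ≤ 4 / n := fun r => by
    refine (unifProb_exists_le _).trans ?_
    refine (sum_le_sum fun ρ _ => unifProb_numCorrect_le H hm _ (Nat.pow_pos hn) hq).trans ?_
    rw [sum_const, card_univ, Fintype.card_fin, nsmul_eq_mul]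
    push_cast
    rw [← pow_mul, mul_div_assoc', div_le_div_iff₀ (by positivity) hnr]
    have : (n : ℝ) * n * n ^ κ ≤ n ^ ((κ - e) * 2) := by
      rw [← sq, ← pow_add]
      exact pow_le_pow_right₀ hn1 (by omega)
    linarith
  calc _ ≤ unifProb (fun J : KFormula n (4 * κ) (n ^ κ) => ¬ Balanced (n ^ (κ - 2)) J ∨
        1 / 4 < unifProb fun r => P J r) := by
        refine unifProb_mono fun J hJ => ?_
        by_cases hbal : Balanced (n ^ (κ - 2)) J
        · refine Or.inr (hJ.trans_le (unifProb_mono fun r hr => ?_))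
          rcases hr with hr | hr | hr
          · omega
          · exact absurd hbal hr
          · exact hr
        · exact Or.inl hbal
    _ ≤ n ^ 2 * ((n ^ κ : ℕ) / (n ^ (κ - 2) : ℕ) ^ 2) + 4 / n / (1 / 4) :=
        (unifProb_or_le _ _).trans (add_le_add (unifProb_not_balanced_le (Nat.pow_pos hn))
          (unifProb_markov P hP (by norm_num)))
    -- The probability of imbalance is at most `n^(6-κ)`, hence the need for `7 ≤ κ`.
    _ ≤ 1 / n + 16 / n := by
        refine add_le_add ?_ (le_of_eq (by ring))
        · push_cast
          rw [← pow_mul, mul_div_assoc', div_le_div_iff₀ (by positivity) hnr, one_mul]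
          rw [← pow_add, ← pow_succ]
          exact pow_le_pow_right₀ hn1 (by omega)
    _ = _ := by ring

end

/-! ### Choice of parameters and conclusion -/

theorem eventually_mul_pow_le_two_pow (c : ℝ) (k : ℕ) :
    ∀ᶠ n : ℕ in atTop, c * (n : ℝ) ^ k ≤ 2 ^ n := by
  have h := (tendsto_pow_const_div_const_pow_of_one_lt k (one_lt_two (α := ℝ))).const_mul c
  rw [mul_zero] at h
  filter_upwards [h.eventually_le_const one_pos] with n hn
  rwa [mul_div_assoc', div_le_one (by positivity)] at hn

/-- With `γ` linear and `κ` quadratic in `g`, the range `4γ` is of order `√κ`, as the second moment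
requires. The lower bounds on `κ`, for concentration (`2 * e + 2`) and for the sample size (`e + (2
* (4 * γ * b) + 1)`), are linear in `γ`, so a `g` large in terms of `b` and `c` meets them. -/
theorem exists_parameters (b c : ℕ) : ∃ κ γ e : ℕ, 200 * (4 * κ + 1) ≤ 16 * γ ^ 2 ∧
    e = 2 * (4 * γ) * c ∧ 2 * e + 2 ≤ κ ∧ 7 ≤ κ ∧ e + (2 * (4 * γ * b) + 1) ≤ κ ∧ 0 < 4 * γ := by
  obtain ⟨g, hg⟩ : ∃ g, g = 16 * c + 8 * b + 1 := ⟨_, rfl⟩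
  have hg1 : 1 ≤ g := by omega
  have h : 100 * g ^ 2 = 1600 * (g * c) + 800 * (g * b) + 100 * g := by
    rw [sq]; nth_rewrite 2 [hg]; ring
  refine ⟨100 * g ^ 2, 100 * g, _, by nlinarith, rfl, ?_, by nlinarith, ?_, by omega⟩
  · rw [h, show 2 * (2 * (4 * (100 * g)) * c) = 1600 * (g * c) by ring]; omega
  · rw [h, show 2 * (4 * (100 * g)) * c = 800 * (g * c) by ring,
      show 2 * (4 * (100 * g) * b) = 800 * (g * b) by ring]; omega

/-- A learner with non-trivial performance refutes random parity constraints. -/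
theorem exists_xorEasy {b : ℕ} {H : LearningRule b} (hH : Efficient H)
    (hN : NonTrivial H (2 / 100)) : ∃ κ > 1, XorEasy (4 * κ) (1 / 100) fun n => n ^ κ := by
  classical
  obtain ⟨c, hc, δ', hδ', hL'⟩ := hN
  -- Capping `δ` at one keeps `1 - δ` nonnegative, so that its powers tend to zero.
  obtain ⟨δ, hδ, hδ1, hL⟩ : ∃ δ > (0 : ℝ), δ ≤ 1 ∧ ∀ᶠ n : ℕ in atTop,
      ∀ D ∈ stdSimplex ℝ (Example n), errHalf D ≤ 2 / 100 →
        δ ≤ successProb H D (1 / 2 - 1 / (n : ℝ) ^ c) :=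
    ⟨min δ' 1, lt_min hδ' one_pos, min_le_right _ _, hL'.mono fun n h D hD hD' =>
      (min_le_left _ _).trans (h D hD hD')⟩
  obtain ⟨c', hc'⟩ := exists_nat_ge c
  obtain ⟨κ, γ, e, hκγ, he, heκ, hκ7, hqκ, hγ⟩ := exists_parameters b c'
  have hκ0 : NeZero (4 * κ) := ⟨by omega⟩
  have hev : ∀ᶠ n : ℕ in atTop, 2 ≤ n ∧ 2 * b + 2 ≤ n ∧ 200 * (n : ℝ) ^ κ ≤ 2 ^ n ∧
      2 * (n : ℝ) ^ κ * n ^ e ≤ 2 ^ n ∧ (1 - δ) ^ n ≤ 1 / 4 ∧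
      ∀ D ∈ stdSimplex ℝ (Example ((n + 1) ^ (4 * γ))), errHalf D ≤ 2 / 100 →
        δ ≤ successProb H D (1 / 2 - 1 / (((n + 1) ^ (4 * γ) : ℕ) : ℝ) ^ c) := by
    have hpow : Tendsto (fun n : ℕ => (n + 1) ^ (4 * γ)) atTop atTop :=
      tendsto_atTop_mono (fun n => (Nat.le_succ n).trans (Nat.le_self_pow hγ.ne' _)) tendsto_id
    have hδn : ∀ᶠ n : ℕ in atTop, (1 - δ) ^ n ≤ 1 / 4 :=
      (tendsto_pow_atTop_nhds_zero_of_lt_one (sub_nonneg.2 hδ1)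
        (by linarith)).eventually_le_const (by norm_num)
    filter_upwards [eventually_ge_atTop 2, eventually_ge_atTop (2 * b + 2),
      eventually_mul_pow_le_two_pow 200 κ, eventually_mul_pow_le_two_pow 2 (κ + e), hδn,
      hpow.eventually hL] with n h1 h2 h3 h4 h5 h6
    exact ⟨h1, h2, h3, by rwa [mul_assoc, ← pow_add], h5, h6⟩
  obtain ⟨n₀, hn₀⟩ := eventually_atTop.1 hev
  obtain ⟨p, B, hB, hp⟩ := exists_prog_accept (K := 4 * κ) (κ := κ) (D := 4 * γ) hH n₀ e
  refine ⟨κ, by omega, p, B, fun n J r =>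
    decide (Accept H (4 * γ) n₀ e J fun x => r (coinIndex (hB n) x)), fun n J r => ?_,
    fun n J hJ => ?_, ?_⟩
  · convert hp n J r
    unfold encProp
    congr!
  · simp only [decide_eq_true_eq]
    refine le_unifProb_accept (δ := δ) (c := c) J hJ (by omega) (by omega)
      hκγ fun hn => ?_
    obtain ⟨h1, h2, h3, h4, h5, h6⟩ := hn₀ n hn
    refine ⟨by omega, h3, h4, ?_, h5, h6⟩
    -- For `n ≥ 2` one has `n + 1 ≤ n²`, so the advantage in dimension `(n + 1)^(4γ)` is at least
    -- `n^(-e)`; this is the factor 2 in `e`.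
    have hn1 : (1 : ℝ) ≤ (((n + 1) ^ (4 * γ) : ℕ) : ℝ) := by
      exact_mod_cast Nat.one_le_pow _ _ (Nat.succ_pos n)
    refine one_div_le_one_div_of_le (Real.rpow_pos_of_pos (by linarith) c) ?_
    calc _ ≤ (((n + 1) ^ (4 * γ) : ℕ) : ℝ) ^ (c' : ℝ) := Real.rpow_le_rpow_of_exponent_le hn1 hc'
      _ ≤ _ := by
        rw [Real.rpow_natCast, he, pow_mul (n : ℝ) _ c', pow_mul (n : ℝ) 2]
        have : (n + 1) ^ (4 * γ) ≤ (n ^ 2) ^ (4 * γ) := Nat.pow_le_pow_left (by nlinarith) _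
        have h7 : (((n + 1) ^ (4 * γ) : ℕ) : ℝ) ≤ ((n : ℝ) ^ 2) ^ (4 * γ) := by exact_mod_cast this
        exact pow_le_pow_left₀ (by positivity) h7 c'
  · refine squeeze_zero' (Eventually.of_forall fun n => unifProb_nonneg _) ?_
      (tendsto_const_div_atTop_nhds_zero_nat 17)
    filter_upwards [eventually_ge_atTop n₀] with n hn
    obtain ⟨h1, h2, -⟩ := hn₀ n hn
    have hq : 2 * numEx b (4 * γ) n ≤ n ^ (κ - e) := by
      have h3 : ((n + 1) ^ (4 * γ)) ^ b ≤ n ^ (2 * (4 * γ * b)) := by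
        rw [← pow_mul]
        calc _ ≤ (n ^ 2) ^ (4 * γ * b) := Nat.pow_le_pow_left (by nlinarith) _
          _ = _ := (pow_mul _ _ _).symm
      have h4 : 1 ≤ n ^ (2 * (4 * γ * b)) := Nat.one_le_pow _ _ (by omega)
      -- The last factor `n ≥ 2b + 2` absorbs the factor 2 and the summand `b` of `numEx`.
      calc _ ≤ n ^ (2 * (4 * γ * b)) * n := by
            unfold numEx
            nlinarith
        _ = n ^ (2 * (4 * γ * b) + 1) := (pow_succ _ _).symm
        _ ≤ _ := Nat.pow_le_pow_right (by omega) (by omega)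
    refine (unifProb_mono fun J hJ => ?_).trans (unifProb_accept_le (H := H) (hB := hB n) hn
      (by omega) (by omega) (by omega) hq)
    simp only [decide_eq_false_iff_not] at hJ
    rw [unifProb_not] at hJ
    linarith

end XorHalf

theorem theorem6
    (hard : ∀ K : ℕ, 4 < K →
      XorHalf.XorHard K (1 / 100) (fun n : ℕ => ⌊(n : ℝ) ^ ((K : ℝ) / 4)⌋₊)) :
    ¬ ∃ (b : ℕ) (H : XorHalf.LearningRule b),
      XorHalf.Efficient H ∧ XorHalf.NonTrivial H (2 / 100) := by
  rintro ⟨b, H, hH, hN⟩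
  obtain ⟨κ, hκ, h⟩ := XorHalf.exists_xorEasy hH hN
  refine hard (4 * κ) (by omega) ?_
  -- As `K = 4κ`, the exponent `K / 4` is an integer and the floor has no effect.
  convert h using 2 with n
  have : ((4 * κ : ℕ) : ℝ) / 4 = κ := by push_cast; ring
  rw [this, Real.rpow_natCast, ← Nat.cast_pow, Nat.floor_natCast]
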